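/- Setting. Let $\Lambda$ be a subset (finite or infinite) of a lattice in $\mathbb R^d$, $d\ge1$, of grid size at least $1$, i.e. any two distinct points of $\Lambda$ have distance $\ge 1$. Let $(h_{xy})_{x,y\in\Lambda}$ be Hermitian, $h_{xy}=\overline{h_{yx}}$, and let $(v_{xy})_{x,y\in\Lambda}$ be real and symmetric, otherwise arbitrary. On the bosonic Fock space $\mathcal F$ over $\ell^2(\Lambda)$, with annihilation and creation operators $a_x,a_x^*$, put for $S\subset\Lambda$ $$H_S=\sum_{x,y\in S}h_{xy}a_x^*a_y+\tfrac12\sum_{x,y\in S}v_{xy}\,a_x^*a_y^*a_ya_x,\qquad \alpha_t^S(A)=e^{itH_S}Ae^{-itH_S},\qquad N_S=\sum_{x\in S}a_x^*a_x,\qquad N=N_\Lambda .$$ For $X\subset\Lambda$ and $\eta>0$ let $X_\eta=\{x\in\Lambda:\operatorname{dist}(x,X)\le\eta\}$ (with $\emptyset_\eta=\emptyset$). For $p=0,1,2,\dots$ let $$\kappa_p=\sup_{x\in\Lambda}\sum_{y\in\Lambda}|h_{xy}|\,|x-y|^{p+1},\qquad \kappa=\kappa_0 .$$ For nonnegative self-adjoint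 operators $A,B$ on $\mathcal F$, the inequality $A\le B$ means that $\operatorname{Tr}(A\rho)\le\operatorname{Tr}(B\rho)$, as elements of $[0,\infty]$, for every positive trace-class operator $\rho$ on $\mathcal F$. Statement. Let $n\ge1$ be an integer with $\kappa_n<\infty$, and let $c>\kappa$. Then there is a constant $C>0$, depending only on $n,\kappa,\kappa_n$ and $c$, such that for all real $\nu,q\ge0$, all $\eta\ge1$, all $X\subset S\subset\Lambda$ and all real $t$ with $|t|<\eta/c$, $$\alpha_t^S\big(N_{S\setminus X_\eta}^{\,q+1}N^{\nu}\big)\;\le\;C\,\big(N_{S\setminus X}N^{\nu+q}+\eta^{-n}N^{\nu+q+1}\big).$$ -/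

import Mathlib

open scoped NNReal ENNReal ComplexConjugate

noncomputable section

namespace LatticeBose

/-- Occupation-number configurations: `m x` bosons at the site `x`, finitely many in total. -/
abbrev Config (Λ : Type*) := Λ →₀ ℕ

/-- The bosonic Fock space over `ℓ²(Λ)` in the occupation-number representation: an element `ψ` is
the square-summable family of its coordinates in the orthonormal basis of (normalized, symmetrized)
occupation-number states. -/
abbrev Fock (Λ : Type*) := lp (fun _ : Config Λ => ℂ) 2

variable {Λ : Type*}

/-- The occupation-number basis vector with configuration `m`. -/
def basisVec (m : Config Λ) : Fock Λ :=
  haveI := Classical.decEq (Config Λ)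
  lp.single 2 m (1 : ℂ)

/-- The annihilation operator `a_x`, acting on coordinates:
`a_x |m⟩ = √(m x) |m - δ_x⟩`. -/
def annih (x : Λ) (ψ : Config Λ → ℂ) : Config Λ → ℂ :=
  fun m => (Real.sqrt (m x + 1) : ℂ) * ψ (m + Finsupp.single x 1)

/-- The creation operator `a_x^*`, acting on coordinates:
`a_x^* |m⟩ = √(m x + 1) |m + δ_x⟩`. (If `m x = 0` the value below is `0`.) -/
def creat (x : Λ) (ψ : Config Λ → ℂ) : Config Λ → ℂ :=
  fun m => (Real.sqrt (m x) : ℂ) * ψ (m - Finsupp.single x 1)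

/-- The Hamiltonian of the region `S`,
`H_S = ∑_{x,y ∈ S} h_{xy} a_x^* a_y + 1/2 ∑_{x,y ∈ S} v_{xy} a_x^* a_y^* a_y a_x`,
acting on coordinates. At a given configuration only finitely many `x` contribute to the first sum
and finitely many pairs to the second one. -/
def hamAction (h : Λ → Λ → ℂ) (v : Λ → Λ → ℝ) (S : Set Λ) (ψ : Config Λ → ℂ) : Config Λ → ℂ :=
  fun m =>
    (∑' x : S, ∑' y : S, h x y * creat (x : Λ) (annih (y : Λ) ψ) m)
    + (1 / 2 : ℂ) * ∑' x : S, ∑' y : S,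
        (v x y : ℂ) * creat (x : Λ) (creat (y : Λ) (annih (y : Λ) (annih (x : Λ) ψ))) m

/-- `U` is the unitary group `e^{-itH_S}`: a strongly continuous one-parameter unitary group on Fock
space whose generator is `-i H_S`, where `H_S` has its natural domain
`{ψ : H_S ψ is square summable}`; that is, `t ↦ U t ψ` has derivative `φ` at `0` if and only if
`i φ = H_S ψ`. -/
structure IsPropagator (h : Λ → Λ → ℂ) (v : Λ → Λ → ℝ) (S : Set Λ)
    (U : ℝ → (Fock Λ ≃ₗᵢ[ℂ] Fock Λ)) : Prop where
  add : ∀ s t, U (s + t) = U s * U t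
  continuous : ∀ ψ, Continuous fun t => U t ψ
  generator : ∀ ψ φ : Fock Λ,
    HasDerivAt (fun t => U t ψ) φ 0 ↔ ∀ m, Complex.I * φ m = hamAction h v S ψ m

open Classical in
/-- The propagator `e^{-itH_S}`. (The value in the second branch is irrelevant: `H_S` preserves the
particle number, and for a Hermitian `h` whose first hopping moment is finite it is, for every
particle number, the sum of a real diagonal and a bounded symmetric operator, hence self-adjoint on
its natural domain.) -/
def propagator (h : Λ → Λ → ℂ) (v : Λ → Λ → ℝ) (S : Set Λ) : ℝ → (Fock Λ ≃ₗᵢ[ℂ] Fock Λ) :=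
  if H : ∃ U, IsPropagator h v S U then H.choose else fun _ => 1

/-- A nonnegative, possibly unbounded, observable `A`, given by its closed quadratic form
`ψ ↦ ⟨ψ, A ψ⟩ = ‖A^{1/2} ψ‖² ∈ [0, ∞]` (infinite off the form domain). -/
abbrev PosObs (Λ : Type*) := Fock Λ → ℝ≥0∞

/-- The (localized) Heisenberg evolution `α_t^S(A) = e^{itH_S} A e^{-itH_S}`. -/
def evol (h : Λ → Λ → ℂ) (v : Λ → Λ → ℝ) (S : Set Λ) (t : ℝ) (A : PosObs Λ) : PosObs Λ :=
  fun ψ => A (propagator h v S t ψ)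

open Classical in
/-- The number of particles in `Y`: the eigenvalue of `N_Y = ∑_{x ∈ Y} a_x^* a_x` on the basis
vector with configuration `m`. -/
def num (Y : Set Λ) (m : Config Λ) : ℝ :=
  ∑ x ∈ m.support with x ∈ Y, (m x : ℝ)

/-- The operator `f` of the occupation numbers, i.e. the one that multiplies the `m`-th coordinate
by `f m`, for a nonnegative function `f`. -/
def ofNum (f : Config Λ → ℝ) : PosObs Λ :=
  fun ψ => ∑' m, ENNReal.ofReal (f m) * ‖ψ m‖ₑ ^ 2

/-- Density operators: positive trace-class operators on Fock space. -/
structure IsDensityOperator (ρ : Fock Λ →L[ℂ] Fock Λ) : Prop where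
  pos : ρ.IsPositive
  trace_lt_top : ∑' m, ENNReal.ofReal (inner ℂ (basisVec m) (ρ (basisVec m))).re < ⊤

/-- The positive square root of a positive bounded operator on a Hilbert space. -/
def sqrtOp {E : Type*} [NormedAddCommGroup E] [InnerProductSpace ℂ E] [CompleteSpace E]
    (ρ : E →L[ℂ] E) : E →L[ℂ] E :=
  CFC.sqrt ρ

/-- The expectation `ω(A) = Tr(A ρ) = Tr(ρ^{1/2} A ρ^{1/2}) ∈ [0, ∞]` of a nonnegative observable
in the state given by `ρ`. -/
def expect (ρ : Fock Λ →L[ℂ] Fock Λ) (A : PosObs Λ) : ℝ≥0∞ :=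
  ∑' m, A (sqrtOp ρ (basisVec m))

/-- The operator inequality `A ≤ B`: `ω(A) ≤ ω(B)` in all states `ω`. -/
def OpLE (A B : PosObs Λ) : Prop :=
  ∀ ρ : Fock Λ →L[ℂ] Fock Λ, IsDensityOperator ρ → expect ρ A ≤ expect ρ B

/-- `κ_p = sup_x ∑_y |h_{xy}| |x - y|^{p+1}`, in `[0, ∞]`. -/
def hopMoment [PseudoMetricSpace Λ] (h : Λ → Λ → ℂ) (p : ℕ) : ℝ≥0∞ :=
  ⨆ x, ∑' y, ENNReal.ofReal (‖h x y‖ * dist x y ^ (p + 1))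

/-- `N_Y = ∑_{x ∈ Y} a_x^* a_x` multiplies the `m`-th coordinate by `num Y m`. -/
theorem tsum_creat_annih (Y : Set Λ) (ψ : Config Λ → ℂ) (m : Config Λ) :
    ∑' x : Y, creat (x : Λ) (annih (x : Λ) ψ) m = (num Y m : ℂ) * ψ m := by
  classical
  have key : ∀ x : Λ, creat x (annih x ψ) m = (m x : ℂ) * ψ m := by
    intro x
    by_cases hx : m x = 0
    · simp [creat, hx]
    · have h1 : Finsupp.single x 1 ≤ m := by
        rw [Finsupp.single_le_iff]; omega
      have h2 : (((m - Finsupp.single x 1 : Config Λ) x : ℕ) : ℝ) + 1 = (m x : ℝ) := by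
        have : (m - Finsupp.single x 1 : Config Λ) x + 1 = m x := by
          simp only [Finsupp.tsub_apply, Finsupp.single_eq_same]; omega
        exact_mod_cast this
      simp only [creat, annih]
      rw [tsub_add_cancel_of_le h1, h2, ← mul_assoc, ← Complex.ofReal_mul,
        Real.mul_self_sqrt (Nat.cast_nonneg _)]
      simp
  simp only [key]
  rw [tsum_subtype Y (fun x => (m x : ℂ) * ψ m),
    tsum_eq_sum (s := m.support.filter (· ∈ Y))]
  · simp only [num, Complex.ofReal_sum, Finset.sum_mul]
    refine Finset.sum_congr rfl fun x hx => ?_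
    simp [(Finset.mem_filter.mp hx).2]
  · intro x hx
    by_cases hY : x ∈ Y
    · have : m x = 0 := by
        by_contra h0
        exact hx (Finset.mem_filter.mpr ⟨Finsupp.mem_support_iff.mpr h0, hY⟩)
      simp [this]
    · simp [hY]

end LatticeBose

end

open scoped NNReal ENNReal ComplexConjugate

noncomputable section

namespace LatticeBose

variable {Λ : Type*}

/-! ### Bounded functions of the occupation numbers -/

/-! The proof follows one observable that moves with the particles. Let `d` be the distance to `X`,
pick a speed `w` with `κ < w < c`, and let `s = (1 - w/c) η`. The front is the second quantization
of `cut n ((d x - w τ) / s)`, restricted to `S`. At `τ = 0` it lives on `S \ X`, and for every `τ ≤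
η / c` it still has full height where `d ≥ η`. So it suffices to bound its growth along the
evolution (`ofNum_num_le`).

Its time derivative has two parts. The motion of the profile contributes `-(w/s)` times the second
quantization of the slope `tent ^ n`. The commutator with the Hamiltonian sees only the off-diagonal
hopping, since the interaction and the diagonal hopping are real functions of the occupation
numbers. By a Schur-type bound it is at most the second quantization of `∑ y, |h x y| |f x - f y|`
(`enorm_two_re_inner_le`). The cutoff satisfies `|cut a - cut b| ≤ (1 + ε) |a - b| tent a ^ n + C |a
- b| ^ (n + 1)` (`abs_cut_sub_le`). Hence this sum is at most `(1 + ε) κ / s` times the slope plus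
`C κn / s ^ (n + 1)` (`tsum_hop_front_le`). As `(1 + ε) κ ≤ w`, the slope terms cancel with the
right sign. The remainder, integrated over a time at most `η / c`, is of order `η ^ (-n)` times the
particle number. No iteration in `n` is needed.

The total particle number is conserved (`sectorProj_comm`), so everything is done on vectors with
exactly `k` particles, where second quantizations of bounded functions are bounded operators. There
`N_Y ^ (q + 1) N ^ ν ≤ N ^ (ν + q) N_Y` reduces all moments to the first one. The constants do not
depend on `k`, so the sectors can be summed (`ofNum_rpow_le`). Derivatives are taken on the domain
of the generator, which is dense. -/

open Classical in
/-- Multiplication by a bounded function of the occupation numbers (`0` for unbounded ones). -/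
def diagOp (a : Config Λ → ℝ) : Fock Λ →L[ℂ] Fock Λ :=
  if h : ∃ C : ℝ, ∀ m, |a m| ≤ C then
    LinearMap.mkContinuous
      { toFun := fun ψ => ⟨fun m => (a m : ℂ) * ψ m, by
          obtain ⟨C, hC⟩ := h
          refine Memℓp.mono' ((lp.memℓp ψ).const_smul (C : ℂ)) fun m => ?_
          simp only [Pi.smul_apply, norm_smul, norm_mul, Complex.norm_real, Real.norm_eq_abs]
          exact mul_le_mul_of_nonneg_right ((hC m).trans (le_abs_self C)) (norm_nonneg _)⟩
        map_add' := fun ψ φ => by ext m; exact mul_add _ _ _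
        map_smul' := fun z ψ => by ext m; simp [mul_left_comm] }
      h.choose fun ψ => by
        have h0 : 0 ≤ h.choose := (abs_nonneg _).trans (h.choose_spec 0)
        calc _ ≤ ‖(h.choose : ℂ) • ψ‖ := lp.norm_mono (by norm_num) fun m => by
              simp only [lp.coeFn_smul, Pi.smul_apply, norm_smul, Complex.norm_real,
                Real.norm_eq_abs, LinearMap.coe_mk, AddHom.coe_mk, norm_mul]
              exact mul_le_mul_of_nonneg_right ((h.choose_spec m).trans (le_abs_self _))
                (norm_nonneg _)
          _ = _ := by rw [norm_smul, Complex.norm_real, Real.norm_of_nonneg h0]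
  else 0

theorem diagOp_apply {a : Config Λ → ℝ} {C : ℝ} (h : ∀ m, |a m| ≤ C) (ψ : Fock Λ)
    (m : Config Λ) : diagOp a ψ m = a m * ψ m := by
  rw [diagOp, dif_pos ⟨C, h⟩]
  rfl

theorem norm_diagOp_le {a : Config Λ → ℝ} {C : ℝ} (h : ∀ m, |a m| ≤ C) : ‖diagOp a‖ ≤ C := by
  have h0 : 0 ≤ C := (abs_nonneg _).trans (h 0)
  refine ContinuousLinearMap.opNorm_le_bound _ h0 fun ψ => ?_
  calc ‖diagOp a ψ‖ ≤ ‖(C : ℂ) • ψ‖ := lp.norm_mono (by norm_num) fun m => by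
        rw [diagOp_apply h]
        simp only [lp.coeFn_smul, Pi.smul_apply, norm_smul, Complex.norm_real,
          Real.norm_eq_abs, norm_mul]
        exact mul_le_mul_of_nonneg_right ((h m).trans (le_abs_self _)) (norm_nonneg _)
    _ = _ := by rw [norm_smul, Complex.norm_real, Real.norm_of_nonneg h0]

theorem inner_diagOp {a : Config Λ → ℝ} {C : ℝ} (h : ∀ m, |a m| ≤ C) (ψ : Fock Λ) :
    HasSum (fun m => a m * ‖ψ m‖ ^ 2) (inner ℂ ψ (diagOp a ψ)).re := by
  have := Complex.hasSum_re (lp.hasSum_inner ψ (diagOp a ψ))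
  convert this using 2 with m
  rw [diagOp_apply h, RCLike.inner_apply, mul_assoc, Complex.mul_conj, ← Complex.ofReal_mul,
    Complex.ofReal_re, Complex.normSq_eq_norm_sq]

theorem inner_diagOp_symm {a : Config Λ → ℝ} {C : ℝ} (h : ∀ m, |a m| ≤ C) (ψ φ : Fock Λ) :
    inner ℂ (diagOp a ψ) φ = inner ℂ ψ (diagOp a φ) := by
  rw [lp.inner_eq_tsum, lp.inner_eq_tsum]
  congr 1
  ext m
  rw [diagOp_apply h, diagOp_apply h, RCLike.inner_apply, RCLike.inner_apply]
  simp
  ring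

theorem ofNum_eq_ofReal_inner {a : Config Λ → ℝ} {C : ℝ} (h : ∀ m, |a m| ≤ C)
    (h0 : ∀ m, 0 ≤ a m) (ψ : Fock Λ) :
    ofNum a ψ = ENNReal.ofReal (inner ℂ ψ (diagOp a ψ)).re := by
  have hs := inner_diagOp h ψ
  rw [← hs.tsum_eq, ENNReal.ofReal_tsum_of_nonneg (fun m => by have := h0 m; positivity)
    hs.summable, ofNum]
  congr 1
  ext m
  rw [ENNReal.ofReal_mul (h0 m), ENNReal.ofReal_pow (norm_nonneg _), ofReal_norm]

theorem ofNum_mono {a b : Config Λ → ℝ} {ψ : Fock Λ} (h : ∀ m, ψ m ≠ 0 → a m ≤ b m) :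
    ofNum a ψ ≤ ofNum b ψ := by
  refine ENNReal.tsum_le_tsum fun m => ?_
  by_cases hm : ψ m = 0
  · simp [hm]
  · gcongr
    exact h m hm

theorem ofNum_const_mul {r : ℝ} (hr : 0 ≤ r) (a : Config Λ → ℝ) (ψ : Fock Λ) :
    ofNum (fun m => r * a m) ψ = ENNReal.ofReal r * ofNum a ψ := by
  simp only [ofNum, ENNReal.ofReal_mul hr, mul_assoc, ENNReal.tsum_mul_left]

/-! ### Sectors of fixed particle number -/

theorem abs_indicator_le_one (p : Prop) [Decidable p] : |if p then (1 : ℝ) else 0| ≤ 1 := by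
  split_ifs <;> simp

/-- The projection onto the sector of `k` particles. -/
def sectorProj (k : ℕ) : Fock Λ →L[ℂ] Fock Λ :=
  diagOp fun m => if m.degree = k then 1 else 0

theorem sectorProj_apply (k : ℕ) (ψ : Fock Λ) (m : Config Λ) :
    sectorProj k ψ m = if m.degree = k then ψ m else 0 := by
  rw [sectorProj, diagOp_apply (fun m => abs_indicator_le_one _)]
  split_ifs <;> simp

theorem sectorProj_eq_self {k : ℕ} {ψ : Fock Λ} (hψ : ∀ m, m.degree ≠ k → ψ m = 0) :
    sectorProj k ψ = ψ := by
  ext m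
  rw [sectorProj_apply]
  split_ifs with h
  · rfl
  · exact (hψ m h).symm

theorem sectorProj_eq_zero (k : ℕ) (ψ : Fock Λ) (m : Config Λ) (hm : m.degree ≠ k) :
    sectorProj k ψ m = 0 := by
  rw [sectorProj_apply, if_neg hm]

theorem ofNum_eq_tsum_sectorProj (a : Config Λ → ℝ) (ψ : Fock Λ) :
    ofNum a ψ = ∑' k, ofNum a (sectorProj k ψ) := by
  simp only [ofNum]
  rw [ENNReal.tsum_comm]
  congr 1
  ext m
  rw [ENNReal.tsum_mul_left, tsum_eq_single m.degree]
  · simp [sectorProj_apply]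
  · intro k hk
    simp [sectorProj_apply, hk.symm]

theorem degree_hop {m : Config Λ} {x : Λ} (hx : m x ≠ 0) (y : Λ) :
    (m - Finsupp.single x 1 + Finsupp.single y 1).degree = m.degree := by
  have h1 : Finsupp.single x 1 ≤ m := by
    rw [Finsupp.single_le_iff]; omega
  have h2 : (m - Finsupp.single x 1 + Finsupp.single x 1).degree = m.degree := by
    rw [tsub_add_cancel_of_le h1]
  simpa using h2

theorem creat_annih_self (x : Λ) (ψ : Config Λ → ℂ) (m : Config Λ) :
    creat x (annih x ψ) m = (m x : ℂ) * ψ m := by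
  by_cases hx : m x = 0
  · simp [creat, hx]
  · have h1 : Finsupp.single x 1 ≤ m := by
      rw [Finsupp.single_le_iff]; omega
    have h2 : (((m - Finsupp.single x 1 : Config Λ) x : ℕ) : ℝ) + 1 = (m x : ℝ) := by
      have : (m - Finsupp.single x 1 : Config Λ) x + 1 = m x := by
        simp only [Finsupp.tsub_apply, Finsupp.single_eq_same]; omega
      exact_mod_cast this
    simp only [creat, annih]
    rw [tsub_add_cancel_of_le h1, h2, ← mul_assoc, ← Complex.ofReal_mul,
      Real.mul_self_sqrt (Nat.cast_nonneg _)]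
    simp

/-- Normal ordering gives `m x * (m y - δ_xy)`, so the interaction is diagonal and will not
contribute to the commutator, whatever the size of `v`. -/
theorem creat_creat_annih_annih (x y : Λ) (ψ : Config Λ → ℂ) (m : Config Λ) :
    creat x (creat y (annih y (annih x ψ))) m
      = ((m x * (m - Finsupp.single x 1 : Config Λ) y : ℕ) : ℂ) * ψ m := by
  have e : creat x (creat y (annih y (annih x ψ))) m
      = ((m - Finsupp.single x 1 : Config Λ) y : ℂ) * creat x (annih x ψ) m := by
    rw [creat, creat_annih_self y, creat]
    ring
  rw [e, creat_annih_self]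
  push_cast
  ring

theorem hamAction_sectorProj (h : Λ → Λ → ℂ) (v : Λ → Λ → ℝ) (S : Set Λ) (k : ℕ) (ψ : Fock Λ)
    (m : Config Λ) :
    hamAction h v S (sectorProj k ψ) m = if m.degree = k then hamAction h v S ψ m else 0 := by
  have e1 : ∀ x y : Λ, creat x (annih y (sectorProj k ψ)) m
      = (if m.degree = k then 1 else 0) * creat x (annih y ψ) m := by
    intro x y
    by_cases hx : m x = 0
    · simp [creat, hx]
    · simp only [creat, annih, sectorProj_apply, degree_hop hx]
      split_ifs <;> simp
  have e2 : ∀ x y : Λ, creat x (creat y (annih y (annih x (sectorProj k ψ)))) m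
      = (if m.degree = k then 1 else 0) * creat x (creat y (annih y (annih x ψ))) m := by
    intro x y
    simp only [creat_creat_annih_annih, sectorProj_apply]
    split_ifs <;> simp
  simp only [hamAction, e1, e2]
  split_ifs <;> simp

/-! ### The propagator -/

namespace IsPropagator

variable {h : Λ → Λ → ℂ} {v : Λ → Λ → ℝ} {S : Set Λ} {U : ℝ → (Fock Λ ≃ₗᵢ[ℂ] Fock Λ)}

theorem zero (hU : IsPropagator h v S U) : U 0 = 1 := by
  have := hU.add 0 0
  rw [add_zero] at this
  exact left_eq_mul.mp this

theorem add_apply (hU : IsPropagator h v S U) (s t : ℝ) (ψ : Fock Λ) :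
    U (s + t) ψ = U s (U t ψ) := by
  rw [hU.add]; rfl

theorem hasDerivAt (hU : IsPropagator h v S U) {ψ φ : Fock Λ}
    (hφ : ∀ m, Complex.I * φ m = hamAction h v S ψ m) (t : ℝ) :
    HasDerivAt (fun t => U t ψ) (U t φ) t := by
  have h0 := (hU.generator ψ φ).2 hφ
  have h1 : HasDerivAt (fun s => U (s - t) ψ) φ t := by
    have : HasDerivAt (fun s => U s ψ) φ (t - t) := by simpa using h0
    simpa using this.comp_sub_const t t
  have h2 := ((U t).toContinuousLinearEquiv : Fock Λ →L[ℂ] Fock Λ).restrictScalars ℝ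
    |>.hasFDerivAt.comp_hasDerivAt t h1
  refine h2.congr_of_eventuallyEq (Filter.Eventually.of_forall fun s => ?_)
  have := hU.add_apply t (s - t) ψ
  rw [add_sub_cancel] at this
  simpa using this

/-- The evolution preserves the domain and commutes with the generator: by the group law, the orbit
of `U t ψ` at `0` is the orbit of `ψ` at `t`. -/
theorem hamAction_apply (hU : IsPropagator h v S U) {ψ φ : Fock Λ}
    (hφ : ∀ m, Complex.I * φ m = hamAction h v S ψ m) (t : ℝ) (m : Config Λ) :
    Complex.I * (U t φ) m = hamAction h v S (U t ψ) m := by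
  refine (hU.generator (U t ψ) (U t φ)).1 ?_ m
  have h1 : HasDerivAt (fun s => U s ψ) (U t φ) (0 + t) := by simpa using hU.hasDerivAt hφ t
  refine (h1.comp_add_const 0 t).congr_of_eventuallyEq (Filter.Eventually.of_forall fun s => ?_)
  exact (hU.add_apply s t ψ).symm

/-- Differentiate the constant `‖U t ψ‖ ^ 2`. -/
theorem re_inner_generator {ψ φ : Fock Λ} (h0 : HasDerivAt (fun t => U t ψ) φ 0)
    (hU0 : U 0 = 1) : (inner ℂ ψ φ).re = 0 := by
  have h1 := h0.inner ℂ h0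
  simp only [LinearIsometryEquiv.inner_map_map, hU0] at h1
  have h2 := congrArg Complex.re (h1.unique (hasDerivAt_const _ _))
  have h3 : (inner ℂ φ ψ).re = (inner ℂ ψ φ).re := inner_re_symm (𝕜 := ℂ) φ ψ
  simp only [LinearIsometryEquiv.coe_one, id_eq, Complex.add_re, Complex.zero_re] at h2
  linarith

/-- The domain of the generator is dense. -/
theorem exists_generator_near (hU : IsPropagator h v S U) (ψ : Fock Λ) {ε : ℝ} (hε : 0 < ε) :
    ∃ ψ' φ : Fock Λ, ‖ψ' - ψ‖ ≤ ε ∧ ∀ m, Complex.I * φ m = hamAction h v S ψ' m := by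
  have hc := hU.continuous ψ
  obtain ⟨δ, hδ, hball⟩ := Metric.continuous_iff.1 hc 0 ε hε
  set r := δ / 2 with hr
  have hr0 : 0 < r := by positivity
  -- The average of an orbit over `[0, r]` lies in the domain, because `U t` only shifts the
  -- interval of integration; the derivative is the difference of the integrand at the endpoints.
  set Ψ : Fock Λ := ∫ s in (0 : ℝ)..r, U s ψ with hΨ
  refine ⟨r⁻¹ • Ψ, r⁻¹ • (U r ψ - ψ), ?_, ?_⟩
  · have e : r⁻¹ • Ψ - ψ = r⁻¹ • ∫ s in (0 : ℝ)..r, (U s ψ - ψ) := by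
      rw [intervalIntegral.integral_sub (hc.intervalIntegrable _ _) (by simp),
        intervalIntegral.integral_const, smul_sub, sub_zero, smul_smul, inv_mul_cancel₀ hr0.ne',
        one_smul]
    have hb : ‖∫ s in (0 : ℝ)..r, (U s ψ - ψ)‖ ≤ ε * |r - 0| := by
      refine intervalIntegral.norm_integral_le_of_norm_le_const fun s hs => ?_
      rw [Set.uIoc_of_le hr0.le] at hs
      have := hball s (by rw [Real.dist_eq, sub_zero, abs_of_pos hs.1]; linarith [hs.2])
      rw [hU.zero, dist_eq_norm] at this
      exact this.le
    rw [e, norm_smul, norm_inv, Real.norm_eq_abs, abs_of_pos hr0]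
    rw [sub_zero, abs_of_pos hr0] at hb
    rw [inv_mul_le_iff₀ hr0]
    linarith
  · refine (hU.generator _ _).1 ?_
    have e : ∀ t, U t (r⁻¹ • Ψ) = r⁻¹ • ((∫ s in (0 : ℝ)..(r + t), U s ψ)
        - ∫ s in (0 : ℝ)..t, U s ψ) := by
      intro t
      have h1 : U t Ψ = ∫ s in (0 : ℝ)..r, U (s + t) ψ := by
        have := ((U t).toContinuousLinearEquiv : Fock Λ →L[ℂ] Fock Λ).intervalIntegral_comp_comm
          (hc.intervalIntegrable (μ := MeasureTheory.volume) 0 r)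
        rw [hΨ]
        refine Eq.trans this.symm ?_
        congr 1
        ext1 s
        rw [add_comm, hU.add_apply]
        rfl
      have h2 : U t (r⁻¹ • Ψ) = r⁻¹ • U t Ψ := by
        have := (U t).map_smul ((r⁻¹ : ℝ) : ℂ) Ψ
        rwa [Complex.coe_smul, Complex.coe_smul] at this
      rw [h2, h1, intervalIntegral.integral_comp_add_right (fun s => U s ψ),
        intervalIntegral.integral_interval_sub_left (hc.intervalIntegrable _ _)
        (hc.intervalIntegrable _ _), zero_add]
    have d1 : HasDerivAt (fun t => ∫ s in (0 : ℝ)..(r + t), U s ψ) (U r ψ) 0 := by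
      have := intervalIntegral.integral_hasDerivAt_right (hc.intervalIntegrable 0 (r + 0))
        (hc.stronglyMeasurableAtFilter _ _) hc.continuousAt
      simpa using this.comp_const_add r 0
    have d2 : HasDerivAt (fun t => ∫ s in (0 : ℝ)..t, U s ψ) ψ 0 := by
      have := intervalIntegral.integral_hasDerivAt_right
        (hc.intervalIntegrable (μ := MeasureTheory.volume) 0 0)
        (hc.stronglyMeasurableAtFilter _ _) hc.continuousAt
      rw [hU.zero] at this
      exact this
    exact ((d1.sub d2).const_smul r⁻¹).congr_of_eventuallyEq (Filter.Eventually.of_forall e)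

theorem generator_sectorProj {ψ φ : Fock Λ}
    (hφ : ∀ m, Complex.I * φ m = hamAction h v S ψ m) (k : ℕ) (m : Config Λ) :
    Complex.I * sectorProj k φ m = hamAction h v S (sectorProj k ψ) m := by
  rw [hamAction_sectorProj, sectorProj_apply, ← hφ m]
  split_ifs <;> simp

/-- This is uniqueness for the Schrödinger equation. The difference of the two sides solves it,
since the Hamiltonian preserves the degree; its norm is therefore constant, and it vanishes at time
`0`. -/
theorem sectorProj_comm_of_generator (hU : IsPropagator h v S U) {ψ φ : Fock Λ}
    (hφ : ∀ m, Complex.I * φ m = hamAction h v S ψ m) (k : ℕ) (t : ℝ) :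
    sectorProj k (U t ψ) = U t (sectorProj k ψ) := by
  set w : ℝ → Fock Λ := fun t => sectorProj k (U t ψ) - U t (sectorProj k ψ) with hw
  set w' : ℝ → Fock Λ := fun t => sectorProj k (U t φ) - U t (sectorProj k φ) with hw'
  have hd : ∀ t, HasDerivAt w (w' t) t := fun t =>
    (((sectorProj k).restrictScalars ℝ).hasFDerivAt.comp_hasDerivAt t (hU.hasDerivAt hφ t)).sub
      (hU.hasDerivAt (generator_sectorProj hφ k) t)
  have hgen : ∀ t, HasDerivAt (fun s => U s (w t)) (w' t) 0 := by
    intro t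
    have h1 := (hU.generator _ _).2 (generator_sectorProj (hU.hamAction_apply hφ t) k)
    have h2 := (hU.generator _ _).2 (hU.hamAction_apply (generator_sectorProj hφ k) t)
    refine (h1.sub h2).congr_of_eventuallyEq (Filter.Eventually.of_forall fun s => ?_)
    exact map_sub (U s) _ _
  have hz : ∀ t, HasDerivAt (fun t => (inner ℂ (w t) (w t)).re) 0 t := by
    intro t
    have h1 := Complex.reCLM.hasFDerivAt.comp_hasDerivAt t ((hd t).inner ℂ (hd t))
    have h2 := re_inner_generator (hgen t) hU.zero
    have h3 : (inner ℂ (w' t) (w t)).re = (inner ℂ (w t) (w' t)).re := inner_re_symm (𝕜 := ℂ) _ _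
    have h4 : Complex.reCLM (inner ℂ (w t) (w' t) + inner ℂ (w' t) (w t)) = 0 := by
      rw [Complex.reCLM_apply, Complex.add_re, h3, h2, add_zero]
    rw [h4] at h1
    exact h1
  have hconst := is_const_of_deriv_eq_zero (fun t => (hz t).differentiableAt)
    (fun t => (hz t).deriv) t 0
  have h0 : w 0 = 0 := by simp [hw, hU.zero]
  rw [h0, inner_zero_left, Complex.zero_re] at hconst
  have : w t = 0 := by
    rw [← inner_self_eq_zero (𝕜 := ℂ)]
    refine Complex.ext hconst ?_
    exact inner_self_im (𝕜 := ℂ) (w t)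
  exact sub_eq_zero.1 this

theorem exists_generator_tendsto (hU : IsPropagator h v S U) (ψ : Fock Λ) :
    ∃ ψ' φ : ℕ → Fock Λ, Filter.Tendsto ψ' Filter.atTop (nhds ψ) ∧
      ∀ j m, Complex.I * φ j m = hamAction h v S (ψ' j) m := by
  choose ψ' φ h1 h2 using fun j : ℕ =>
    hU.exists_generator_near ψ (ε := 1 / ((j : ℝ) + 1)) (by positivity)
  refine ⟨ψ', φ, ?_, h2⟩
  rw [tendsto_iff_norm_sub_tendsto_zero]
  exact squeeze_zero (fun _ => norm_nonneg _) h1 tendsto_one_div_add_atTop_nhds_zero_nat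

theorem sectorProj_comm (hU : IsPropagator h v S U) (ψ : Fock Λ) (k : ℕ) (t : ℝ) :
    sectorProj k (U t ψ) = U t (sectorProj k ψ) := by
  obtain ⟨ψ', φ, h1, h2⟩ := hU.exists_generator_tendsto ψ
  refine tendsto_nhds_unique (f := fun j => sectorProj k (U t (ψ' j))) (l := Filter.atTop) ?_ ?_
  · exact ((sectorProj k).continuous.tendsto _).comp (((U t).continuous.tendsto _).comp h1)
  · simp only [fun j => hU.sectorProj_comm_of_generator (h2 j) k t]
    exact ((U t).continuous.tendsto _).comp (((sectorProj k).continuous.tendsto _).comp h1)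

end IsPropagator

/-! ### A cutoff function with a slowly varying derivative -/

/-- If `r ≤ δ w`, then `r` costs only a factor `(1 + δ) ^ n`; otherwise `w` is at most a multiple of
`r`. A leading factor arbitrarily close to `1` is what permits every speed `c > κ`. -/
theorem exists_add_pow_le (n : ℕ) {ε : ℝ} (hε : 0 < ε) :
    ∃ C : ℝ, 0 < C ∧ ∀ w r : ℝ, 0 ≤ w → 0 ≤ r → (w + r) ^ n ≤ (1 + ε) * w ^ n + C * r ^ n := by
  obtain ⟨δ, hδ, hδε⟩ : ∃ δ : ℝ, 0 < δ ∧ (1 + δ) ^ n ≤ 1 + ε := by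
    have hc : Continuous fun δ : ℝ => (1 + δ) ^ n := by fun_prop
    obtain ⟨δ, hδ, hball⟩ := Metric.continuous_iff.1 hc 0 ε hε
    refine ⟨δ / 2, by positivity, ?_⟩
    have := hball (δ / 2) (by rw [Real.dist_eq, sub_zero, abs_of_pos (by positivity)]; linarith)
    rw [Real.dist_eq, add_zero, one_pow] at this
    linarith [(abs_lt.1 this).2]
  refine ⟨(δ⁻¹ + 1) ^ n, by positivity, fun w r hw hr => ?_⟩
  rcases le_total r (δ * w) with h | h
  · calc (w + r) ^ n ≤ ((1 + δ) * w) ^ n := by gcongr; linarith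
      _ = (1 + δ) ^ n * w ^ n := mul_pow _ _ _
      _ ≤ (1 + ε) * w ^ n := by gcongr
      _ ≤ _ := le_add_of_nonneg_right (by positivity)
  · have : w ≤ δ⁻¹ * r := by rw [le_inv_mul_iff₀ hδ]; exact h
    calc (w + r) ^ n ≤ ((δ⁻¹ + 1) * r) ^ n := by gcongr; linarith
      _ = (δ⁻¹ + 1) ^ n * r ^ n := mul_pow _ _ _
      _ ≤ _ := le_add_of_nonneg_left (by positivity)

/-- The distance of a point to the complement of the unit interval. -/
def tent (u : ℝ) : ℝ := max 0 (min u (1 - u))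

theorem tent_nonneg (u : ℝ) : 0 ≤ tent u := le_max_left _ _

theorem tent_le_one (u : ℝ) : tent u ≤ 1 := by
  refine max_le zero_le_one ?_
  rcases le_total u 1 with h | h
  · exact (min_le_left _ _).trans h
  · exact (min_le_right _ _).trans (by linarith)

theorem tent_of_nonpos {u : ℝ} (h : u ≤ 0) : tent u = 0 :=
  max_eq_left ((min_le_left _ _).trans h)

theorem tent_of_one_le {u : ℝ} (h : 1 ≤ u) : tent u = 0 :=
  max_eq_left ((min_le_right _ _).trans (by linarith))

theorem tent_le_add (a b : ℝ) : tent b ≤ tent a + |b - a| := by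
  have h1 := le_abs_self (b - a)
  have h2 := neg_abs_le (b - a)
  have h3 := abs_nonneg (b - a)
  unfold tent
  rcases max_choice 0 (min b (1 - b)) with h | h <;> rw [h]
  · exact add_nonneg (le_max_left _ _) h3
  · have : min b (1 - b) ≤ min a (1 - a) + |b - a| := by
      rw [← min_add_add_right]
      exact min_le_min (by linarith) (by linarith)
    linarith [le_max_right 0 (min a (1 - a))]

theorem continuous_tent : Continuous tent := by
  unfold tent; fun_prop

theorem abs_tent_pow_sub_le (n : ℕ) (a b : ℝ) : |tent b ^ n - tent a ^ n| ≤ n * |b - a| := by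
  have h1 : |tent b - tent a| ≤ |b - a| := by
    rw [abs_sub_le_iff]
    have := tent_le_add b a
    rw [abs_sub_comm] at this
    constructor <;> linarith [tent_le_add a b]
  have h2 : max |tent b| |tent a| ^ (n - 1) ≤ 1 := by
    refine pow_le_one₀ (le_max_of_le_left (abs_nonneg _)) ?_
    rw [abs_of_nonneg (tent_nonneg _), abs_of_nonneg (tent_nonneg _)]
    exact max_le (tent_le_one _) (tent_le_one _)
  calc _ ≤ |tent b - tent a| * n * max |tent b| |tent a| ^ (n - 1) := abs_pow_sub_pow_le ..
    _ ≤ |b - a| * n * 1 := by gcongr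
    _ = _ := by ring

/-- A cutoff function: it vanishes on `(-∞, 0]`, is constant on `[1, ∞)`, and its derivative is the
`n`-th power of the distance to the complement of `[0, 1]`. -/
def cut (n : ℕ) (u : ℝ) : ℝ := ∫ s in (0 : ℝ)..u, tent s ^ n

theorem continuous_tent_pow (n : ℕ) : Continuous fun s => tent s ^ n := continuous_tent.pow n

theorem cut_sub (n : ℕ) (a b : ℝ) : cut n b - cut n a = ∫ s in a..b, tent s ^ n :=
  intervalIntegral.integral_interval_sub_left ((continuous_tent_pow n).intervalIntegrable _ _)
    ((continuous_tent_pow n).intervalIntegrable _ _)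

theorem monotone_cut (n : ℕ) : Monotone (cut n) := fun a b hab => by
  rw [← sub_nonneg, cut_sub]
  exact intervalIntegral.integral_nonneg hab fun s _ => pow_nonneg (tent_nonneg s) n

theorem cut_zero (n : ℕ) : cut n 0 = 0 := by simp [cut]

theorem cut_of_nonpos {n : ℕ} (hn : 1 ≤ n) {u : ℝ} (hu : u ≤ 0) : cut n u = 0 := by
  rw [cut, intervalIntegral.integral_symm, neg_eq_zero]
  refine intervalIntegral.integral_zero_ae (Filter.Eventually.of_forall fun s hs => ?_)
  rw [Set.uIoc_of_le hu] at hs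
  -- Here `1 ≤ n` matters, as `0 ^ 0 = 1`.
  rw [tent_of_nonpos hs.2, zero_pow (by omega)]

theorem cut_of_one_le {n : ℕ} (hn : 1 ≤ n) {u : ℝ} (hu : 1 ≤ u) : cut n u = cut n 1 := by
  rw [← sub_eq_zero, cut_sub]
  refine intervalIntegral.integral_zero_ae (Filter.Eventually.of_forall fun s hs => ?_)
  rw [Set.uIoc_of_le hu] at hs
  rw [tent_of_one_le hs.1.le, zero_pow (by omega)]

theorem cut_nonneg {n : ℕ} (hn : 1 ≤ n) (u : ℝ) : 0 ≤ cut n u := by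
  rcases le_total u 0 with h | h
  · rw [cut_of_nonpos hn h]
  · rw [← cut_zero n]; exact monotone_cut n h

theorem cut_le {n : ℕ} (hn : 1 ≤ n) (u : ℝ) : cut n u ≤ cut n 1 := by
  rcases le_total u 1 with h | h
  · exact monotone_cut n h
  · rw [cut_of_one_le hn h]

theorem cut_one_pos (n : ℕ) : 0 < cut n 1 := by
  refine intervalIntegral.intervalIntegral_pos_of_pos_on
    ((continuous_tent_pow n).intervalIntegrable _ _) (fun s hs => ?_) zero_lt_one
  exact pow_pos (lt_max_of_lt_right (lt_min hs.1 (sub_pos.2 hs.2))) n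

/-- Since `tent` is 1-Lipschitz, the integrand at `s` is at most `(tent a + |s - a|) ^ n`. The slope
is evaluated at the endpoint `a` itself, so that it can later be compared with the slope of the
moving front at the same site. -/
theorem abs_cut_sub_le {n : ℕ} {ε C : ℝ}
    (h : ∀ w r : ℝ, 0 ≤ w → 0 ≤ r → (w + r) ^ n ≤ (1 + ε) * w ^ n + C * r ^ n) (hC : 0 ≤ C)
    (a b : ℝ) :
    |cut n a - cut n b| ≤ (1 + ε) * |a - b| * tent a ^ n + C * |a - b| ^ (n + 1) := by
  rw [abs_sub_comm, cut_sub, ← Real.norm_eq_abs, abs_sub_comm a b]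
  refine (intervalIntegral.norm_integral_le_of_norm_le_const
    (C := (1 + ε) * tent a ^ n + C * |b - a| ^ n) fun s hs => ?_).trans (le_of_eq (by ring))
  have hs' : |s - a| ≤ |b - a| := Set.abs_sub_left_of_mem_uIcc (Set.uIoc_subset_uIcc hs)
  rw [Real.norm_of_nonneg (pow_nonneg (tent_nonneg _) _)]
  calc tent s ^ n ≤ (tent a + |s - a|) ^ n := by
        gcongr
        · exact tent_nonneg _
        · exact tent_le_add _ _
    _ ≤ (1 + ε) * tent a ^ n + C * |s - a| ^ n := h _ _ (tent_nonneg _) (abs_nonneg _)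
    _ ≤ _ := by gcongr

/-- A first-order Taylor bound, uniform in `a`; it makes the moving front differentiable in operator
norm. -/
theorem abs_cut_sub_sub_le (n : ℕ) (a b : ℝ) :
    |cut n b - cut n a - (b - a) * tent a ^ n| ≤ n * |b - a| ^ 2 := by
  have e : cut n b - cut n a - (b - a) * tent a ^ n
      = ∫ s in a..b, (tent s ^ n - tent a ^ n) := by
    rw [intervalIntegral.integral_sub ((continuous_tent_pow n).intervalIntegrable _ _) (by simp),
      cut_sub, intervalIntegral.integral_const, smul_eq_mul]
  rw [e, ← Real.norm_eq_abs]
  refine (intervalIntegral.norm_integral_le_of_norm_le_const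
    (C := n * |b - a|) fun s hs => ?_).trans (le_of_eq (by ring))
  have hs' : |s - a| ≤ |b - a| := Set.abs_sub_left_of_mem_uIcc (Set.uIoc_subset_uIcc hs)
  exact (abs_tent_pow_sub_le n a s).trans (by gcongr)

/-! ### Second quantization of functions on the lattice -/

/-- The eigenvalue `∑ x, f x * m x` of the second quantization of `f`. -/
def occ (f : Λ → ℝ) (m : Config Λ) : ℝ := m.sum fun x j => (j : ℝ) * f x

theorem occ_add_single (f : Λ → ℝ) (m : Config Λ) (x : Λ) :
    occ f (m + Finsupp.single x 1) = occ f m + f x := by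
  classical
  rw [occ, Finsupp.sum_add_index' (by simp) (by intros; push_cast; ring), Finsupp.sum_single_index]
  · simp [occ]
  · simp

theorem occ_add_smul (f g : Λ → ℝ) (r s : ℝ) (m : Config Λ) :
    occ (fun x => r * f x + s * g x) m = r * occ f m + s * occ g m := by
  simp only [occ, Finsupp.sum, Finset.mul_sum, ← Finset.sum_add_distrib]
  exact Finset.sum_congr rfl fun x _ => by ring

theorem occ_const_mul (f : Λ → ℝ) (r : ℝ) (m : Config Λ) :
    occ (fun x => r * f x) m = r * occ f m := by
  simp only [occ, Finsupp.sum, Finset.mul_sum, mul_left_comm]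

theorem occ_nonneg {f : Λ → ℝ} (hf : ∀ x, 0 ≤ f x) (m : Config Λ) : 0 ≤ occ f m :=
  Finset.sum_nonneg fun x _ => mul_nonneg (Nat.cast_nonneg _) (hf x)

theorem occ_mono {f g : Λ → ℝ} (h : ∀ x, f x ≤ g x) (m : Config Λ) : occ f m ≤ occ g m :=
  Finset.sum_le_sum fun x _ => mul_le_mul_of_nonneg_left (h x) (Nat.cast_nonneg _)

theorem occ_const (r : ℝ) (m : Config Λ) : occ (fun _ => r) m = r * m.degree := by
  simp [occ, Finsupp.sum, Finsupp.degree_apply, Finset.mul_sum, mul_comm]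

theorem abs_occ_le {f : Λ → ℝ} {B : ℝ} (h : ∀ x, |f x| ≤ B) (m : Config Λ) :
    |occ f m| ≤ B * m.degree := by
  rw [← occ_const, occ, Finsupp.sum]
  refine (Finset.abs_sum_le_sum_abs _ _).trans (Finset.sum_le_sum fun x _ => ?_)
  rw [abs_mul, Nat.abs_cast]
  exact mul_le_mul_of_nonneg_left (h x) (Nat.cast_nonneg _)

open Classical in
theorem num_eq_occ (Y : Set Λ) (m : Config Λ) :
    num Y m = occ (fun x => if x ∈ Y then 1 else 0) m := by
  simp [num, occ, Finsupp.sum, Finset.sum_filter]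

theorem num_univ (m : Config Λ) : num Set.univ m = m.degree := by
  simp [num_eq_occ, occ_const]

/-- The restriction to the sector of `k` particles. -/
def restrictSector (k : ℕ) (a : Config Λ → ℝ) (m : Config Λ) : ℝ := if m.degree = k then a m else 0

theorem abs_restrictSector_occ_le {f : Λ → ℝ} {B : ℝ} (hB : 0 ≤ B) (h : ∀ x, |f x| ≤ B) (k : ℕ)
    (m : Config Λ) : |restrictSector k (occ f) m| ≤ B * k := by
  unfold restrictSector
  split_ifs with hm
  · rw [← hm]; exact abs_occ_le h m
  · rw [abs_zero]; positivity

theorem ofNum_restrictSector {k : ℕ} {ψ : Fock Λ} (hψ : ∀ m, m.degree ≠ k → ψ m = 0)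
    (a : Config Λ → ℝ) : ofNum (restrictSector k a) ψ = ofNum a ψ := by
  unfold ofNum restrictSector
  congr 1
  ext m
  by_cases hm : m.degree = k
  · simp [hm]
  · simp [hψ m hm]

/-- The identity `∑ x, g x ‖a_x ψ‖ ^ 2 = ⟨ψ, dΓ(g) ψ⟩`, by the substitution `m = l + δ_x`;
configurations with `m x = 0` are missed but have weight `0`. -/
theorem tsum_annih (g : Λ → ℝ) (hg : ∀ x, 0 ≤ g x) (ψ : Fock Λ) :
    ∑' p : Config Λ × Λ, ENNReal.ofReal (g p.2) * ‖annih p.2 ψ p.1‖ₑ ^ 2 = ofNum (occ g) ψ := by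
  have hinj : Function.Injective
      fun p : Config Λ × Λ => (p.1 + Finsupp.single p.2 1, p.2) := by
    rintro ⟨l, x⟩ ⟨l', x'⟩ h
    obtain ⟨h1, rfl⟩ := Prod.mk.inj h
    exact Prod.ext (add_right_cancel h1) rfl
  have h1 := hinj.tsum_eq
    (f := fun p : Config Λ × Λ => ENNReal.ofReal (p.1 p.2 * g p.2) * ‖ψ p.1‖ₑ ^ 2) (by
      rintro ⟨m, x⟩ h
      have hx : m x ≠ 0 := by
        intro h0
        simp [h0] at h
      refine ⟨(m - Finsupp.single x 1, x), ?_⟩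
      simp only [Prod.mk.injEq, and_true]
      exact tsub_add_cancel_of_le (by rw [Finsupp.single_le_iff]; omega))
  have h2 : ∀ p : Config Λ × Λ, ENNReal.ofReal (g p.2) * ‖annih p.2 ψ p.1‖ₑ ^ 2
      = ENNReal.ofReal ((p.1 + Finsupp.single p.2 1 : Config Λ) p.2 * g p.2)
        * ‖ψ (p.1 + Finsupp.single p.2 1)‖ₑ ^ 2 := by
    rintro ⟨l, x⟩
    have e : ‖(Real.sqrt (l x + 1) : ℂ)‖ₑ ^ 2 = ENNReal.ofReal ((l x : ℝ) + 1) := by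
      rw [← ofReal_norm, Complex.norm_real, Real.norm_of_nonneg (Real.sqrt_nonneg _),
        ← ENNReal.ofReal_pow (Real.sqrt_nonneg _), Real.sq_sqrt (by positivity)]
    simp only [annih, enorm_mul, mul_pow, e, Finsupp.add_apply, Finsupp.single_eq_same]
    rw [ENNReal.ofReal_mul (by positivity)]
    push_cast
    ring
  simp only [h2]
  refine h1.trans ?_
  rw [ENNReal.tsum_prod', ofNum]
  congr 1
  ext m
  dsimp only
  rw [ENNReal.tsum_mul_right, tsum_eq_sum (s := m.support), occ, Finsupp.sum,
    ENNReal.ofReal_sum_of_nonneg fun x _ => mul_nonneg (Nat.cast_nonneg _) (hg x)]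
  intro x hx
  simp [Finsupp.notMem_support_iff.1 hx]

/-- The Schur test: `2ab ≤ a ^ 2 + b ^ 2`, and by the symmetry of `w` both squares give the same
sum. -/
theorem tsum_annih_mul_annih_le (w : Λ → Λ → ℝ≥0∞) (hw : ∀ x y, w x y = w y x) (g : Λ → ℝ)
    (hg : ∀ x, 0 ≤ g x) (hwg : ∀ x, ∑' y, w x y ≤ ENNReal.ofReal (g x)) (ψ : Fock Λ) :
    ∑' p : Config Λ × Λ × Λ, w p.2.1 p.2.2 * (‖annih p.2.1 ψ p.1‖ₑ * ‖annih p.2.2 ψ p.1‖ₑ)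
      ≤ ofNum (occ g) ψ := by
  set T : ℝ≥0∞ :=
    ∑' p : Config Λ × Λ × Λ, w p.2.1 p.2.2 * ‖annih p.2.1 ψ p.1‖ₑ ^ 2 with hT
  have hT' : ∑' p : Config Λ × Λ × Λ, w p.2.1 p.2.2 * ‖annih p.2.2 ψ p.1‖ₑ ^ 2 = T := by
    rw [hT, ← ((Equiv.refl (Config Λ)).prodCongr (Equiv.prodComm Λ Λ)).tsum_eq]
    congr 1
    ext p
    simp [hw p.2.1 p.2.2]
  have hle : T ≤ ofNum (occ g) ψ := by
    rw [← tsum_annih g hg, hT, ENNReal.tsum_prod', ENNReal.tsum_prod']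
    refine ENNReal.tsum_le_tsum fun l => ?_
    rw [ENNReal.tsum_prod']
    refine ENNReal.tsum_le_tsum fun x => ?_
    dsimp only
    rw [ENNReal.tsum_mul_right]
    gcongr
    exact hwg x
  refine le_trans ?_ hle
  have h2 : 2 * ∑' p : Config Λ × Λ × Λ,
      w p.2.1 p.2.2 * (‖annih p.2.1 ψ p.1‖ₑ * ‖annih p.2.2 ψ p.1‖ₑ) ≤ 2 * T := by
    rw [two_mul T]
    nth_rw 2 [← hT']
    rw [hT, ← ENNReal.tsum_mul_left, ← ENNReal.tsum_add]
    refine ENNReal.tsum_le_tsum fun p => ?_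
    rw [← mul_add, mul_left_comm]
    gcongr
    simp only [enorm_eq_nnnorm]
    norm_cast
    rw [← mul_assoc]
    exact two_mul_le_add_sq _ _
  exact (ENNReal.mul_le_mul_iff_right two_ne_zero ENNReal.ofNat_ne_top).1 h2

/-! ### The hopping part of the Hamiltonian -/

open Classical in
/-- The off-diagonal part of the hopping matrix, restricted to the region `S`. -/
def hop (h : Λ → Λ → ℂ) (S : Set Λ) (x y : Λ) : ℂ := if x ∈ S ∧ y ∈ S ∧ x ≠ y then h x y else 0

theorem conj_hop {h : Λ → Λ → ℂ} (hh : ∀ x y, h x y = conj (h y x)) (S : Set Λ) (x y : Λ) :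
    conj (hop h S y x) = hop h S x y := by
  unfold hop
  by_cases hxy : x ∈ S ∧ y ∈ S ∧ x ≠ y
  · rw [if_pos hxy, if_pos ⟨hxy.2.1, hxy.1, hxy.2.2.symm⟩, ← hh]
  · rw [if_neg hxy, if_neg fun H => hxy ⟨H.2.1, H.1, H.2.2.symm⟩, map_zero]

theorem norm_creat_annih_le {ψ : Config Λ → ℂ} {B : ℝ} (hψ : ∀ m, ‖ψ m‖ ≤ B) (x y : Λ)
    (m : Config Λ) :
    ‖creat x (annih y ψ) m‖ ≤ Real.sqrt (m x) * (Real.sqrt (m.degree + 1) * B) := by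
  simp only [creat, annih, norm_mul, Complex.norm_real, Real.norm_of_nonneg (Real.sqrt_nonneg _)]
  gcongr
  · have h1 : (m - Finsupp.single x 1 : Config Λ) y ≤ m y := by simp
    exact h1.trans (Finsupp.le_degree y m)
  · exact hψ _

/-- What matters is that `D` is real, by hermiticity of `h` on the diagonal: such a term cancels in
the commutator. The sums over `x` are finite, because `creat x` vanishes at `m` unless `m x ≠ 0`;
only the sums over `y` need summability. -/
theorem hamAction_eq_diag_add_hop {h : Λ → Λ → ℂ} (hh : ∀ x y, h x y = conj (h y x))
    (v : Λ → Λ → ℝ) (S : Set Λ) (hsum : ∀ x, Summable fun y => hop h S x y)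
    {ψ : Config Λ → ℂ} {B : ℝ} (hψ : ∀ m, ‖ψ m‖ ≤ B) (m : Config Λ) :
    ∃ D : ℝ, hamAction h v S ψ m
      = D * ψ m + ∑' x, ∑' y, hop h S x y * creat x (annih y ψ) m := by
  classical
  have hreal : ∀ x, ((h x x).re : ℂ) = h x x := fun x => by
    rw [← Complex.conj_eq_iff_re]; exact (hh x x).symm
  have hs : ∀ x, Summable fun y => hop h S x y * creat x (annih y ψ) m := fun x =>
    Summable.of_norm_bounded
      ((hsum x).norm.mul_right (Real.sqrt (m x) * (Real.sqrt (m.degree + 1) * B))) fun y => by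
        rw [norm_mul]
        gcongr
        exact norm_creat_annih_le hψ x y m
  have h1 : ∀ x : S, ∑' y : S, h x y * creat (x : Λ) (annih (y : Λ) ψ) m
      = (((h x x).re * m x : ℝ) : ℂ) * ψ m
        + ∑' y, hop h S x y * creat (x : Λ) (annih y ψ) m := by
    rintro ⟨x, hx⟩
    simp only
    rw [tsum_subtype S (fun y => h x y * creat x (annih y ψ) m)]
    have hd : HasSum (fun y => if y = x then h x x * creat x (annih x ψ) m else 0)
        (h x x * creat x (annih x ψ) m) := hasSum_ite_eq x _
    have := (hd.add (hs x).hasSum).tsum_eq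
    rw [creat_annih_self] at this
    push_cast
    rw [hreal, mul_assoc, ← this]
    congr 1
    ext y
    by_cases hy : y ∈ S <;> by_cases hyx : y = x
    · subst hyx
      simp [hop, hx, creat_annih_self]
    · simp [hop, hx, hy, hyx, Ne.symm hyx]
    · subst hyx; exact absurd hx hy
    · simp [hop, hy, hyx]
  have h2 : ∑' x : S, ∑' y : S, h x y * creat (x : Λ) (annih (y : Λ) ψ) m
      = ((∑' x : S, (h x x).re * m x : ℝ) : ℂ) * ψ m
        + ∑' x, ∑' y, hop h S x y * creat x (annih y ψ) m := by
    simp only [h1]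
    have hfin : (Function.support fun x : S => m (x : Λ)).Finite := by
      refine Set.Finite.of_finite_image (f := Subtype.val) (m.support.finite_toSet.subset ?_)
        Subtype.val_injective.injOn
      rintro _ ⟨x, hx, rfl⟩
      simpa using hx
    have s1 : Summable fun x : S => (((h x x).re * m x : ℝ) : ℂ) * ψ m := by
      refine summable_of_hasFiniteSupport (hfin.subset fun x hx => ?_)
      intro h0
      simp [show m (x : Λ) = 0 from h0] at hx
    have s2 : Summable fun x : S => ∑' y, hop h S x y * creat (x : Λ) (annih y ψ) m := by
      refine summable_of_hasFiniteSupport (hfin.subset fun x hx => ?_)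
      intro h0
      simp [creat, show m (x : Λ) = 0 from h0] at hx
    rw [s1.tsum_add s2, tsum_mul_right, Complex.ofReal_tsum,
      tsum_subtype S (fun x => ∑' y, hop h S x y * creat x (annih y ψ) m)]
    congr 2
    ext x
    by_cases hx : x ∈ S
    · simp [hx]
    · simp [hx, hop]
  refine ⟨∑' x : S, (h x x).re * m x + 1 / 2 * ∑' x : S, ∑' y : S,
    v x y * ((m x * (m - Finsupp.single (x : Λ) 1 : Config Λ) y : ℕ) : ℝ), ?_⟩
  rw [hamAction, h2]
  simp only [creat_creat_annih_annih, ← mul_assoc, tsum_mul_right]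
  push_cast
  ring

/-! ### The commutator of the Hamiltonian with a second-quantized function -/

theorem ofNum_occ_const_ne_top {k : ℕ} {ψ : Fock Λ} (hψ : ∀ m, m.degree ≠ k → ψ m = 0) {r : ℝ}
    (hr : 0 ≤ r) : ofNum (occ fun _ : Λ => r) ψ ≠ ⊤ := by
  rw [← ofNum_restrictSector hψ, ofNum_eq_ofReal_inner
    (abs_restrictSector_occ_le hr (fun _ => (abs_of_nonneg hr).le) k)]
  · exact ENNReal.ofReal_ne_top
  · intro m
    unfold restrictSector
    split_ifs
    · exact occ_nonneg (fun _ => hr) m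
    · exact le_rfl

variable {h : Λ → Λ → ℂ} {S : Set Λ}

/-- A summand of the hopping energy, weighted by `a`. -/
def hopTerm (h : Λ → Λ → ℂ) (S : Set Λ) (a : Config Λ → ℝ) (ψ : Config Λ → ℂ)
    (p : Config Λ × Λ × Λ) : ℂ :=
  a p.1 * conj (ψ p.1) * (hop h S p.2.1 p.2.2 * creat p.2.1 (annih p.2.2 ψ) p.1)

/-- `hopTerm`, in terms of the configuration without the hopping particle. -/
def hopTerm' (h : Λ → Λ → ℂ) (S : Set Λ) (a : Config Λ → ℝ) (ψ : Config Λ → ℂ)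
    (p : Config Λ × Λ × Λ) : ℂ :=
  a (p.1 + Finsupp.single p.2.1 1) * hop h S p.2.1 p.2.2
    * (conj (annih p.2.1 ψ p.1) * annih p.2.2 ψ p.1)

/-- Adding a particle at the first of two sites. -/
def addParticle (p : Config Λ × Λ × Λ) : Config Λ × Λ × Λ := (p.1 + Finsupp.single p.2.1 1, p.2)

theorem injective_addParticle : Function.Injective (addParticle (Λ := Λ)) := by
  rintro ⟨l, x, y⟩ ⟨l', x', y'⟩ hp
  obtain ⟨h1, h2⟩ := Prod.mk.inj hp
  obtain ⟨rfl, rfl⟩ := Prod.mk.inj h2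
  exact Prod.ext (add_right_cancel h1) rfl

theorem hopTerm_addParticle (a : Config Λ → ℝ) (ψ : Config Λ → ℂ) (p : Config Λ × Λ × Λ) :
    hopTerm h S a ψ (addParticle p) = hopTerm' h S a ψ p := by
  simp only [hopTerm, hopTerm', addParticle, creat, annih, add_tsub_cancel_right,
    Finsupp.add_apply, Finsupp.single_eq_same, map_mul, Complex.conj_ofReal]
  push_cast
  ring

/-- A term with `m x = 0` vanishes, so nothing is lost by passing to the configuration `m - δ_x`, in
which the two sites play symmetric roles. -/
theorem support_hopTerm_subset (a : Config Λ → ℝ) (ψ : Config Λ → ℂ) :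
    Function.support (hopTerm h S a ψ) ⊆ Set.range addParticle := by
  rintro ⟨m, x, y⟩ hp
  have hx : m x ≠ 0 := by
    intro h0
    simp [hopTerm, creat, h0] at hp
  refine ⟨(m - Finsupp.single x 1, x, y), ?_⟩
  simp only [addParticle, Prod.mk.injEq, and_true]
  exact tsub_add_cancel_of_le (by rw [Finsupp.single_le_iff]; omega)

theorem summable_hopTerm' (hh : ∀ x y, h x y = conj (h y x)) {K : ℝ} (hK0 : 0 ≤ K)
    (hK : ∀ x, ∑' y, ‖hop h S x y‖ₑ ≤ ENNReal.ofReal K) {a : Config Λ → ℝ} {B : ℝ}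
    (ha : ∀ m, |a m| ≤ B) {k : ℕ} {ψ : Fock Λ} (hψ : ∀ m, m.degree ≠ k → ψ m = 0) :
    Summable (hopTerm' h S a ψ) := by
  refine Summable.of_enorm (ne_top_of_le_ne_top (ENNReal.mul_ne_top
    (ENNReal.ofReal_ne_top (r := B)) (ofNum_occ_const_ne_top hψ hK0)) ?_)
  refine le_trans ?_ (mul_le_mul_right (tsum_annih_mul_annih_le (fun x y => ‖hop h S x y‖ₑ)
    (fun x y => by rw [← conj_hop hh S x y, RCLike.enorm_conj]) (fun _ => K) (fun _ => hK0) hK ψ) _)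
  rw [← ENNReal.tsum_mul_left]
  refine ENNReal.tsum_le_tsum fun p => ?_
  simp only [hopTerm', enorm_mul, RCLike.enorm_conj, mul_assoc]
  gcongr
  rw [← ofReal_norm, Complex.norm_real]
  exact ENNReal.ofReal_le_ofReal (ha _)

/-- Exchanging `x` and `y` and conjugating changes a summand only in its weight, from the value at
`l + δ_x` to the value at `l + δ_y`. The difference of the weights is `f x - f y` or `0`, which is
the commutator in coordinates. -/
theorem enorm_im_tsum_hopTerm'_le (hh : ∀ x y, h x y = conj (h y x)) {K : ℝ} (hK0 : 0 ≤ K)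
    (hK : ∀ x, ∑' y, ‖hop h S x y‖ₑ ≤ ENNReal.ofReal K) {f : Λ → ℝ} {B : ℝ} (hB : 0 ≤ B)
    (hf : ∀ x, |f x| ≤ B) {g : Λ → ℝ} (hg : ∀ x, 0 ≤ g x)
    (hfg : ∀ x, ∑' y, ‖hop h S x y‖ₑ * ‖f x - f y‖ₑ ≤ ENNReal.ofReal (g x))
    {k : ℕ} {ψ : Fock Λ} (hψ : ∀ m, m.degree ≠ k → ψ m = 0) :
    ‖2 * (∑' p, hopTerm' h S (restrictSector k (occ f)) ψ p).im‖ₑ ≤ ofNum (occ g) ψ := by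
  set A := hopTerm' h S (restrictSector k (occ f)) ψ with hA
  have hs : Summable A := summable_hopTerm' hh hK0 hK (abs_restrictSector_occ_le hB hf k) hψ
  set e : Config Λ × Λ × Λ ≃ Config Λ × Λ × Λ :=
    (Equiv.refl (Config Λ)).prodCongr (Equiv.prodComm Λ Λ) with he
  have hs' : Summable fun p => conj (A (e p)) :=
    (Complex.conjCLE.summable (f := fun p => A (e p))).2 (e.summable_iff.2 hs)
  have h1 : ((2 * (∑' p, A p).im : ℝ) : ℂ) * Complex.I = ∑' p, (A p - conj (A (e p))) := by
    rw [hs.tsum_sub hs', ← Complex.conj_tsum, e.tsum_eq A, Complex.sub_conj]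
  have h2 : ‖2 * (∑' p, A p).im‖ₑ = ‖∑' p, (A p - conj (A (e p)))‖ₑ := by
    rw [← h1, ← ofReal_norm, ← ofReal_norm, norm_mul _ Complex.I, Complex.norm_I, mul_one,
      Complex.norm_real]
  rw [h2]
  refine enorm_tsum_le_tsum_enorm.trans (le_trans ?_ (tsum_annih_mul_annih_le
    (fun x y => ‖hop h S x y‖ₑ * ‖f x - f y‖ₑ) (fun x y => ?_) g hg hfg ψ))
  · refine ENNReal.tsum_le_tsum ?_
    rintro ⟨l, x, y⟩
    have h3 : A (l, x, y) - conj (A (e (l, x, y)))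
        = ((restrictSector k (occ f) (l + Finsupp.single x 1)
            - restrictSector k (occ f) (l + Finsupp.single y 1) : ℝ) : ℂ)
          * hop h S x y * (conj (annih x ψ l) * annih y ψ l) := by
      simp only [hA, he, hopTerm', Equiv.prodCongr_apply, Equiv.coe_refl, Prod.map_apply, id_eq,
        Equiv.prodComm_apply, Prod.swap_prod_mk, map_mul, Complex.conj_ofReal, Complex.conj_conj,
        conj_hop hh S]
      push_cast
      ring
    rw [h3]
    simp only [enorm_mul, RCLike.enorm_conj, mul_assoc]
    rw [mul_left_comm]
    gcongr
    rw [← ofReal_norm, ← ofReal_norm, Complex.norm_real]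
    refine ENNReal.ofReal_le_ofReal ?_
    simp only [restrictSector, map_add, Finsupp.degree_single, occ_add_single]
    split_ifs
    · rw [add_sub_add_left_eq_sub]
    · simp
  · rw [← conj_hop hh S x y, RCLike.enorm_conj, ← neg_sub (f y), enorm_neg]

/-- The left side is the rate of change of the second quantization of `f` along the evolution. With
`φ = -i H ψ`, the real diagonal part of `H` contributes a purely imaginary number, so only the
hopping sum remains. -/
theorem enorm_two_re_inner_le (hh : ∀ x y, h x y = conj (h y x)) (v : Λ → Λ → ℝ) {K : ℝ}
    (hK0 : 0 ≤ K) (hK : ∀ x, ∑' y, ‖hop h S x y‖ₑ ≤ ENNReal.ofReal K) {f : Λ → ℝ} {B : ℝ}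
    (hB : 0 ≤ B) (hf : ∀ x, |f x| ≤ B) {g : Λ → ℝ} (hg : ∀ x, 0 ≤ g x)
    (hfg : ∀ x, ∑' y, ‖hop h S x y‖ₑ * ‖f x - f y‖ₑ ≤ ENNReal.ofReal (g x))
    {k : ℕ} {ψ φ : Fock Λ} (hψ : ∀ m, m.degree ≠ k → ψ m = 0)
    (hφ : ∀ m, Complex.I * φ m = hamAction h v S ψ m) :
    ‖2 * (inner ℂ (diagOp (restrictSector k (occ f)) ψ) φ).re‖ₑ ≤ ofNum (occ g) ψ := by
  set a := restrictSector k (occ f) with ha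
  have hab := abs_restrictSector_occ_le hB hf k
  have hs' : Summable (hopTerm' h S a ψ) := summable_hopTerm' hh hK0 hK hab hψ
  have hs : Summable (hopTerm h S a ψ) := by
    refine (injective_addParticle.summable_iff fun p hp => ?_).1 ?_
    · by_contra h0
      exact hp (support_hopTerm_subset a ψ h0)
    · exact hs'.congr fun p => (hopTerm_addParticle a ψ p).symm
  have htsum : ∑' p, hopTerm h S a ψ p = ∑' p, hopTerm' h S a ψ p := by
    rw [← injective_addParticle.tsum_eq (support_hopTerm_subset a ψ)]
    exact tsum_congr fun p => hopTerm_addParticle a ψ p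
  have key : (inner ℂ (diagOp a ψ) φ).re = (∑' p, hopTerm' h S a ψ p).im := by
    rw [← htsum, hs.tsum_prod, lp.inner_eq_tsum, Complex.re_tsum (lp.summable_inner _ _),
      Complex.im_tsum hs.prod]
    congr 1
    ext m
    obtain ⟨D, hD⟩ := hamAction_eq_diag_add_hop hh v S
      (fun x => Summable.of_enorm (ne_top_of_le_ne_top ENNReal.ofReal_ne_top (hK x)))
      (fun m => lp.norm_apply_le_norm two_ne_zero ψ m) m
    rw [(hs.prod_factor m).tsum_prod]
    simp only [hopTerm, tsum_mul_left]
    set T := ∑' x, ∑' y, hop h S x y * creat x (annih y ψ) m with hT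
    have hφm : φ m = -Complex.I * (D * ψ m + T) := by
      rw [← hD, ← hφ m, neg_mul, ← mul_assoc, Complex.I_mul_I]; ring
    rw [diagOp_apply hab, RCLike.inner_apply, hφm]
    simp
    ring
  rw [key]
  exact enorm_im_tsum_hopTerm'_le hh hK0 hK hB hf hg hfg hψ

/-! ### Propagation of a moving front -/

open Classical in
/-- The restriction of a function on the lattice to the region `S`. -/
def onRegion (S : Set Λ) (f : Λ → ℝ) (x : Λ) : ℝ := if x ∈ S then f x else 0

theorem onRegion_nonneg {S : Set Λ} {f : Λ → ℝ} (hf : ∀ x, 0 ≤ f x) (x : Λ) :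
    0 ≤ onRegion S f x := by
  unfold onRegion; split_ifs
  exacts [hf x, le_rfl]

theorem abs_onRegion_le {S : Set Λ} {f : Λ → ℝ} {B : ℝ} (hB : 0 ≤ B) (hf : ∀ x, |f x| ≤ B)
    (x : Λ) : |onRegion S f x| ≤ B := by
  unfold onRegion; split_ifs
  exacts [hf x, by rwa [abs_zero]]

theorem restrictSector_nonneg {a : Config Λ → ℝ} (ha : ∀ m, 0 ≤ a m) (k : ℕ) (m : Config Λ) :
    0 ≤ restrictSector k a m := by
  unfold restrictSector; split_ifs
  exacts [ha m, le_rfl]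

/-- The second quantization of `f` on the sector of `k` particles. -/
def secondQuant (k : ℕ) (f : Λ → ℝ) : Fock Λ →L[ℂ] Fock Λ := diagOp (restrictSector k (occ f))

theorem norm_secondQuant_le {f : Λ → ℝ} {B : ℝ} (hB : 0 ≤ B) (hf : ∀ x, |f x| ≤ B) (k : ℕ) :
    ‖secondQuant k f‖ ≤ B * k := norm_diagOp_le (abs_restrictSector_occ_le hB hf k)

theorem ofNum_occ_eq {f : Λ → ℝ} {B : ℝ} (hf0 : ∀ x, 0 ≤ f x) (hB : 0 ≤ B) (hf : ∀ x, |f x| ≤ B)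
    {k : ℕ} {ψ : Fock Λ} (hψ : ∀ m, m.degree ≠ k → ψ m = 0) :
    ofNum (occ f) ψ = ENNReal.ofReal (inner ℂ ψ (secondQuant k f ψ)).re := by
  rw [← ofNum_restrictSector hψ, ofNum_eq_ofReal_inner (abs_restrictSector_occ_le hB hf k)
    (restrictSector_nonneg (occ_nonneg hf0) k), secondQuant]

theorem secondQuant_add_smul {f g : Λ → ℝ} {B B' : ℝ} (hB : 0 ≤ B) (hf : ∀ x, |f x| ≤ B)
    (hB' : 0 ≤ B') (hg : ∀ x, |g x| ≤ B') (k : ℕ) (r s : ℝ) :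
    secondQuant k (fun x => r * f x + s * g x)
      = r • secondQuant k f + s • secondQuant k g := by
  ext ψ m
  have hfg : ∀ x, |r * f x + s * g x| ≤ |r| * B + |s| * B' := fun x =>
    (abs_add_le _ _).trans (by rw [abs_mul, abs_mul]; gcongr; exacts [hf x, hg x])
  have e : (r • secondQuant k f + s • secondQuant k g) ψ m
      = r * secondQuant k f ψ m + s * secondQuant k g ψ m := by
    rw [← Complex.real_smul, ← Complex.real_smul]
    rfl
  rw [e, secondQuant, secondQuant, secondQuant,
    diagOp_apply (abs_restrictSector_occ_le (by positivity) hfg k),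
    diagOp_apply (abs_restrictSector_occ_le hB hf k),
    diagOp_apply (abs_restrictSector_occ_le hB' hg k)]
  unfold restrictSector
  rw [occ_add_smul]
  split_ifs
  · push_cast; ring
  · simp

/-- The profile at time `τ` of a front of width `s` that moves with the speed `w`. -/
def front (n : ℕ) (S : Set Λ) (d : Λ → ℝ) (w s τ : ℝ) : Λ → ℝ :=
  onRegion S fun x => cut n ((d x - w * τ) / s)

/-- The slope of `front`, in units of `1 / s`. -/
def frontSlope (n : ℕ) (S : Set Λ) (d : Λ → ℝ) (w s τ : ℝ) : Λ → ℝ :=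
  onRegion S fun x => tent ((d x - w * τ) / s) ^ n

section Front

variable {n : ℕ} {S : Set Λ} {d : Λ → ℝ} {w s : ℝ}

theorem front_nonneg (hn : 1 ≤ n) (τ : ℝ) (x : Λ) : 0 ≤ front n S d w s τ x :=
  onRegion_nonneg (fun _ => cut_nonneg hn _) x

theorem abs_front_le (hn : 1 ≤ n) (τ : ℝ) (x : Λ) : |front n S d w s τ x| ≤ cut n 1 :=
  abs_onRegion_le (cut_one_pos n).le
    (fun _ => by rw [abs_of_nonneg (cut_nonneg hn _)]; exact cut_le hn _) x

theorem frontSlope_nonneg (τ : ℝ) (x : Λ) : 0 ≤ frontSlope n S d w s τ x :=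
  onRegion_nonneg (fun _ => pow_nonneg (tent_nonneg _) n) x

theorem abs_frontSlope_le (τ : ℝ) (x : Λ) : |frontSlope n S d w s τ x| ≤ 1 :=
  abs_onRegion_le zero_le_one (fun _ => by
    rw [abs_of_nonneg (pow_nonneg (tent_nonneg _) n)]
    exact pow_le_one₀ (tent_nonneg _) (tent_le_one _)) x

/-- The redundant factors `1` and `-1` match two nested applications of `secondQuant_add_smul`. -/
theorem abs_front_sub_sub_le (τ δ : ℝ) (x : Λ) :
    |1 * (1 * front n S d w s (τ + δ) x + (-1) * front n S d w s τ x)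
      + δ * (w / s) * frontSlope n S d w s τ x| ≤ n * (w / s) ^ 2 * δ ^ 2 := by
  unfold front frontSlope onRegion
  split_ifs with hx
  · have := abs_cut_sub_sub_le n ((d x - w * τ) / s) ((d x - w * (τ + δ)) / s)
    have e : (d x - w * (τ + δ)) / s - (d x - w * τ) / s = -(w / s * δ) := by ring
    rw [e, sq_abs] at this
    refine le_trans (le_of_eq ?_) (this.trans (le_of_eq (by ring)))
    congr 1
    ring
  · simp only [mul_zero, add_zero, abs_zero]
    positivity

/-- The Taylor remainder is `O(δ ^ 2)` uniformly in the site, and `k` particles multiply it by at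
most `k`. -/
theorem hasDerivAt_secondQuant_front (hn : 1 ≤ n) (k : ℕ) (τ : ℝ) :
    HasDerivAt (fun τ => secondQuant k (front n S d w s τ))
      (-(w / s) • secondQuant k (frontSlope n S d w s τ)) τ := by
  rw [hasDerivAt_iff_isLittleO_nhds_zero]
  refine Asymptotics.IsBigO.trans_isLittleO (g := fun δ : ℝ => δ ^ 2)
    (Asymptotics.IsBigO.of_bound (n * (w / s) ^ 2 * k) (Filter.Eventually.of_forall fun δ => ?_))
    (Asymptotics.isLittleO_pow_id one_lt_two)
  have hB := (cut_one_pos n).le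
  have hb1 : ∀ x, |1 * front n S d w s (τ + δ) x + (-1) * front n S d w s τ x| ≤ 2 * cut n 1 :=
    fun x => by
      have h1 := abs_front_le (S := S) (d := d) (w := w) (s := s) hn (τ + δ) x
      have h2 := abs_front_le (S := S) (d := d) (w := w) (s := s) hn τ x
      rw [one_mul, neg_one_mul, ← sub_eq_add_neg]
      exact (abs_sub _ _).trans (by linarith)
  have e := secondQuant_add_smul (by positivity) hb1 zero_le_one
    (abs_frontSlope_le (n := n) (S := S) (d := d) (w := w) (s := s) τ) k 1 (δ * (w / s))
  rw [secondQuant_add_smul hB (abs_front_le hn (τ + δ)) hB (abs_front_le hn τ)] at e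
  have e2 : secondQuant k (front n S d w s (τ + δ)) - secondQuant k (front n S d w s τ)
      - δ • -(w / s) • secondQuant k (frontSlope n S d w s τ)
      = (1 : ℝ) • ((1 : ℝ) • secondQuant k (front n S d w s (τ + δ))
          + (-1 : ℝ) • secondQuant k (front n S d w s τ))
        + (δ * (w / s)) • secondQuant k (frontSlope n S d w s τ) := by
    module
  rw [e2, ← e]
  refine (norm_secondQuant_le (by positivity) (abs_front_sub_sub_le τ δ) k).trans
    (le_of_eq ?_)
  rw [Real.norm_of_nonneg (sq_nonneg δ)]
  ring

end Front

/-! ### Commutator bound for the front, and its growth in time -/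

section Transport

variable {h : Λ → Λ → ℂ} {v : Λ → Λ → ℝ} {S : Set Λ}

theorem enorm_hop_le (x y : Λ) : ‖hop h S x y‖ₑ ≤ ‖h x y‖ₑ := by
  unfold hop; split_ifs <;> simp

theorem hop_of_notMem {x : Λ} (hx : x ∉ S) (y : Λ) : hop h S x y = 0 := by simp [hop, hx]

theorem hop_of_notMem_right {y : Λ} (hy : y ∉ S) (x : Λ) : hop h S x y = 0 := by simp [hop, hy]

/-- The linear term of `abs_cut_sub_le` is summed by `κ`, the term of order `n + 1` by `κn`. The
slope then has the factor `(1 + ε) κ / s ≤ w / s`, no more than the motion of the front removes. -/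
theorem tsum_hop_front_le [PseudoMetricSpace Λ] {n : ℕ} {d : Λ → ℝ}
    (hd : ∀ x y, |d x - d y| ≤ dist x y) {κ κn ε C w s : ℝ} (hκ0 : 0 ≤ κ)
    (hκ : ∀ x, ∑' y, ENNReal.ofReal (‖h x y‖ * dist x y) ≤ ENNReal.ofReal κ)
    (hκn : ∀ x, ∑' y, ENNReal.ofReal (‖h x y‖ * dist x y ^ (n + 1)) ≤ ENNReal.ofReal κn)
    (hε : 0 < ε) (hC : 0 < C) (hκn0 : 0 ≤ κn)
    (hεC : ∀ w r : ℝ, 0 ≤ w → 0 ≤ r → (w + r) ^ n ≤ (1 + ε) * w ^ n + C * r ^ n)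
    (hw : (1 + ε) * κ ≤ w) (hs : 0 < s) (τ : ℝ) (x : Λ) :
    ∑' y, ‖hop h S x y‖ₑ * ‖front n S d w s τ x - front n S d w s τ y‖ₑ
      ≤ ENNReal.ofReal (w / s * frontSlope n S d w s τ x + C * κn / s ^ (n + 1) * 1) := by
  by_cases hx : x ∈ S
  swap
  · simp [hop_of_notMem hx]
  set b := tent ((d x - w * τ) / s) ^ n with hb
  have hb0 : 0 ≤ b := pow_nonneg (tent_nonneg _) n
  have hterm : ∀ y, ‖hop h S x y‖ₑ * ‖front n S d w s τ x - front n S d w s τ y‖ₑ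
      ≤ ENNReal.ofReal ((1 + ε) * b / s) * ENNReal.ofReal (‖h x y‖ * dist x y)
        + ENNReal.ofReal (C / s ^ (n + 1)) * ENNReal.ofReal (‖h x y‖ * dist x y ^ (n + 1)) := by
    intro y
    by_cases hy : y ∈ S
    swap
    · simp [hop_of_notMem_right hy]
    rw [← ENNReal.ofReal_mul (by positivity), ← ENNReal.ofReal_mul (by positivity),
      ← ENNReal.ofReal_add (by positivity) (by positivity)]
    refine (mul_le_mul_left (enorm_hop_le x y) _).trans ?_
    rw [← ofReal_norm, ← ofReal_norm, ← ENNReal.ofReal_mul (norm_nonneg _)]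
    refine ENNReal.ofReal_le_ofReal ?_
    have h1 := abs_cut_sub_le hεC hC.le ((d x - w * τ) / s) ((d y - w * τ) / s)
    have h2 : |(d x - w * τ) / s - (d y - w * τ) / s| ≤ dist x y / s := by
      rw [← sub_div, sub_sub_sub_cancel_right, abs_div, abs_of_pos hs]
      gcongr
      exact hd x y
    simp only [front, onRegion, hx, hy, if_true, Real.norm_eq_abs]
    calc ‖h x y‖ * |cut n ((d x - w * τ) / s) - cut n ((d y - w * τ) / s)|
        ≤ ‖h x y‖ * ((1 + ε) * (dist x y / s) * b + C * (dist x y / s) ^ (n + 1)) := by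
          gcongr
          exact h1.trans (by gcongr)
      _ = _ := by rw [div_pow]; ring
  refine (ENNReal.tsum_le_tsum hterm).trans ?_
  rw [ENNReal.tsum_add, ENNReal.tsum_mul_left, ENNReal.tsum_mul_left]
  refine (add_le_add (mul_le_mul_right (hκ x) _) (mul_le_mul_right (hκn x) _)).trans ?_
  rw [← ENNReal.ofReal_mul (by positivity), ← ENNReal.ofReal_mul (by positivity),
    ← ENNReal.ofReal_add (by positivity) (by positivity)]
  refine ENNReal.ofReal_le_ofReal ?_
  simp only [frontSlope, onRegion, hx, if_true]
  rw [← hb]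
  have : (1 + ε) * b / s * κ ≤ w / s * b := by
    calc _ = (1 + ε) * κ / s * b := by ring
      _ ≤ _ := by gcongr
  linarith [show C / s ^ (n + 1) * κn = C * κn / s ^ (n + 1) * 1 by ring]

theorem inner_secondQuant_one_le (k : ℕ) (ψ : Fock Λ) :
    (inner ℂ ψ (secondQuant k (fun _ => 1) ψ)).re ≤ k * ‖ψ‖ ^ 2 := by
  have h1 : ‖secondQuant k (fun _ : Λ => 1)‖ ≤ 1 * k :=
    norm_secondQuant_le zero_le_one (fun _ => abs_one.le) k
  calc _ ≤ ‖inner ℂ ψ (secondQuant k (fun _ => 1) ψ)‖ := Complex.re_le_norm _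
    _ ≤ ‖ψ‖ * ‖secondQuant k (fun _ => 1) ψ‖ := norm_inner_le_norm _ _
    _ ≤ ‖ψ‖ * (1 * k * ‖ψ‖) := by gcongr; exact (secondQuant k _).le_of_opNorm_le h1 ψ
    _ = _ := by ring

namespace IsPropagator

variable {U : ℝ → (Fock Λ ≃ₗᵢ[ℂ] Fock Λ)}

theorem apply_eq_zero_of_degree_ne (hU : IsPropagator h v S U) {k : ℕ} {ψ : Fock Λ}
    (hψ : ∀ m, m.degree ≠ k → ψ m = 0) (t : ℝ) (m : Config Λ) (hm : m.degree ≠ k) :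
    U t ψ m = 0 := by
  rw [← sectorProj_eq_self hψ, ← hU.sectorProj_comm, sectorProj_apply, if_neg hm]

/-- The front observable grows at most linearly in time, with a small rate. -/
theorem inner_front_le_of_generator [PseudoMetricSpace Λ] (hU : IsPropagator h v S U)
    (hh : ∀ x y, h x y = conj (h y x)) {n : ℕ} (hn : 1 ≤ n) {d : Λ → ℝ}
    (hd : ∀ x y, |d x - d y| ≤ dist x y) {κ κn ε C w s : ℝ} (hκ0 : 0 ≤ κ)
    (hK : ∀ x, ∑' y, ‖hop h S x y‖ₑ ≤ ENNReal.ofReal κ)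
    (hκ : ∀ x, ∑' y, ENNReal.ofReal (‖h x y‖ * dist x y) ≤ ENNReal.ofReal κ)
    (hκn : ∀ x, ∑' y, ENNReal.ofReal (‖h x y‖ * dist x y ^ (n + 1)) ≤ ENNReal.ofReal κn)
    (hε : 0 < ε) (hC : 0 < C) (hκn0 : 0 ≤ κn)
    (hεC : ∀ w r : ℝ, 0 ≤ w → 0 ≤ r → (w + r) ^ n ≤ (1 + ε) * w ^ n + C * r ^ n)
    (hw : (1 + ε) * κ ≤ w) (hs : 0 < s) {σ : ℝ} (hσ : |σ| = 1) {k : ℕ} {ψ φ : Fock Λ}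
    (hψ : ∀ m, m.degree ≠ k → ψ m = 0)
    (hφ : ∀ m, Complex.I * φ m = hamAction h v S ψ m) {T : ℝ} (hT : 0 ≤ T) :
    (inner ℂ (U (σ * T) ψ) (secondQuant k (front n S d w s T) (U (σ * T) ψ))).re
      ≤ (inner ℂ ψ (secondQuant k (front n S d w s 0) ψ)).re
        + C * κn / s ^ (n + 1) * (k * ‖ψ‖ ^ 2) * T := by
  have hw0 : 0 ≤ w := le_trans (by positivity) hw
  set R := C * κn / s ^ (n + 1) with hR
  have hR0 : 0 ≤ R := by positivity
  set F : ℝ → ℝ := fun τ =>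
    (inner ℂ (U (σ * τ) ψ) (secondQuant k (front n S d w s τ) (U (σ * τ) ψ))).re with hF
  set ψt : ℝ → Fock Λ := fun τ => U (σ * τ) ψ with hψt
  set φt : ℝ → Fock Λ := fun τ => U (σ * τ) φ with hφt
  have hdψ : ∀ τ, HasDerivAt ψt (σ • φt τ) τ := fun τ => by
    have h1 := (hU.hasDerivAt hφ (σ * τ)).scomp τ ((hasDerivAt_id τ).const_mul σ)
    rw [mul_one] at h1
    exact h1
  set M : ℝ → Fock Λ →L[ℂ] Fock Λ := fun τ => secondQuant k (front n S d w s τ) with hM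
  set M' : ℝ → Fock Λ →L[ℂ] Fock Λ := fun τ => secondQuant k (frontSlope n S d w s τ) with hM'
  have hdF : ∀ τ, HasDerivAt F (-(w / s) * (inner ℂ (ψt τ) (M' τ (ψt τ))).re
      + σ * (2 * (inner ℂ (M τ (ψt τ)) (φt τ)).re)) τ := by
    intro τ
    have hres : HasDerivAt (fun τ => (M τ).restrictScalars ℝ)
        ((-(w / s) • M' τ).restrictScalars ℝ) τ :=
      (ContinuousLinearMap.restrictScalarsL ℂ (Fock Λ) (Fock Λ) ℝ ℝ).hasFDerivAt.comp_hasDerivAt τ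
        (hasDerivAt_secondQuant_front (S := S) (d := d) (w := w) (s := s) hn k τ)
    have h1 := hres.clm_apply (hdψ τ)
    have h2 := Complex.reCLM.hasFDerivAt.comp_hasDerivAt τ ((hdψ τ).inner ℂ h1)
    have h3 : Complex.reCLM (inner ℂ (ψt τ) (((-(w / s) • M' τ).restrictScalars ℝ) (ψt τ)
          + ((M τ).restrictScalars ℝ) (σ • φt τ))
        + inner ℂ (σ • φt τ) (((M τ).restrictScalars ℝ) (ψt τ)))
        = -(w / s) * (inner ℂ (ψt τ) (M' τ (ψt τ))).re
          + σ * (2 * (inner ℂ (M τ (ψt τ)) (φt τ)).re) := by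
      have a1 : inner ℂ (M τ (ψt τ)) (φt τ) = inner ℂ (ψt τ) (M τ (φt τ)) :=
        inner_diagOp_symm (abs_restrictSector_occ_le (cut_one_pos n).le (abs_front_le hn τ) k) _ _
      have a2 : (inner ℂ (φt τ) (M τ (ψt τ))).re = (inner ℂ (M τ (ψt τ)) (φt τ)).re :=
        inner_re_symm (𝕜 := ℂ) _ _
      have a3 : ((M τ).restrictScalars ℝ) (σ • φt τ) = σ • M τ (φt τ) :=
        map_smul ((M τ).restrictScalars ℝ) σ (φt τ)
      have a4 : ((-(w / s) • M' τ).restrictScalars ℝ) (ψt τ) = (-(w / s)) • M' τ (ψt τ) := rfl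
      have a5 : ((M τ).restrictScalars ℝ) (ψt τ) = M τ (ψt τ) := rfl
      rw [a3, a4, a5, inner_add_right, Complex.reCLM_apply, Complex.add_re, Complex.add_re,
        inner_smul_right_eq_smul, inner_smul_right_eq_smul, inner_smul_left_eq_smul]
      simp only [Complex.smul_re, smul_eq_mul]
      rw [a2, a1]
      ring
    rw [h3] at h2
    exact h2
  -- The slope term in the commutator bound cancels the one from the moving profile. What is left is
  -- `R` times the particle number.
  have hbound : ∀ τ, deriv F τ ≤ R * (k * ‖ψ‖ ^ 2) := by
    intro τ
    rw [(hdF τ).deriv]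
    have hsec : ∀ m, m.degree ≠ k → ψt τ m = 0 := hU.apply_eq_zero_of_degree_ne hψ _
    have hws : 0 ≤ w / s := by positivity
    have hg0 : ∀ x, 0 ≤ w / s * frontSlope n S d w s τ x + R * 1 := fun x =>
      add_nonneg (mul_nonneg hws (frontSlope_nonneg τ x)) (by simpa using hR0)
    have hgb : ∀ x, |w / s * frontSlope n S d w s τ x + R * 1| ≤ w / s * 1 + R * 1 := fun x => by
      rw [abs_of_nonneg (hg0 x)]
      gcongr
      exact (le_abs_self _).trans (abs_frontSlope_le τ x)
    have h1 := enorm_two_re_inner_le hh v hκ0 hK (cut_one_pos n).le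
      (abs_front_le (S := S) (d := d) (w := w) (s := s) hn τ) hg0
      (tsum_hop_front_le hd hκ0 hκ hκn hε hC hκn0 hεC hw hs τ) hsec (hU.hamAction_apply hφ (σ * τ))
    have h2 : (inner ℂ (ψt τ) (secondQuant k
        (fun x => w / s * frontSlope n S d w s τ x + R * 1) (ψt τ))).re
        = w / s * (inner ℂ (ψt τ) (M' τ (ψt τ))).re
          + R * (inner ℂ (ψt τ) (secondQuant k (fun _ => 1) (ψt τ))).re := by
      rw [secondQuant_add_smul zero_le_one (abs_frontSlope_le τ) zero_le_one
        (fun _ => abs_one.le) k (w / s) R]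
      have a1 : ((w / s) • secondQuant k (frontSlope n S d w s τ)
          + R • secondQuant k (fun _ => 1) : Fock Λ →L[ℂ] Fock Λ) (ψt τ)
          = (w / s) • M' τ (ψt τ) + R • secondQuant k (fun _ => 1) (ψt τ) := rfl
      rw [a1, inner_add_right, inner_smul_right_eq_smul, inner_smul_right_eq_smul]
      simp
    rw [ofNum_occ_eq hg0 (by positivity) hgb hsec, h2, ← ofReal_norm] at h1
    have hM'0 : 0 ≤ (inner ℂ (ψt τ) (M' τ (ψt τ))).re :=
      (inner_diagOp (abs_restrictSector_occ_le zero_le_one (abs_frontSlope_le τ) k)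
        (ψt τ)).nonneg fun m => mul_nonneg
          (restrictSector_nonneg (occ_nonneg (frontSlope_nonneg τ)) k m) (sq_nonneg _)
    have h10 : 0 ≤ (inner ℂ (ψt τ) (secondQuant k (fun _ => 1) (ψt τ))).re :=
      (inner_diagOp (abs_restrictSector_occ_le zero_le_one (fun _ => abs_one.le) k)
        (ψt τ)).nonneg fun m => mul_nonneg
          (restrictSector_nonneg (occ_nonneg fun _ => zero_le_one) k m) (sq_nonneg _)
    have h3 := (ENNReal.ofReal_le_ofReal_iff (by positivity)).1 h1
    have h4 := inner_secondQuant_one_le k (ψt τ)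
    have h5 : ‖ψt τ‖ = ‖ψ‖ := (U _).norm_map ψ
    rw [h5] at h4
    have h6 : σ * (2 * (inner ℂ (M τ (ψt τ)) (φt τ)).re)
        ≤ ‖2 * (inner ℂ (M τ (ψt τ)) (φt τ)).re‖ := by
      refine (le_abs_self _).trans (le_of_eq ?_)
      rw [abs_mul, hσ, one_mul, Real.norm_eq_abs]
    have h7 := mul_le_mul_of_nonneg_left h4 hR0
    have h8 : ‖2 * (inner ℂ (M τ (ψt τ)) (φt τ)).re‖ ≤ _ := h3
    linarith
  have := image_sub_le_mul_sub_of_deriv_le (fun τ => (hdF τ).differentiableAt) hbound hT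
  have hF0 : F 0 = (inner ℂ ψ (secondQuant k (front n S d w s 0) ψ)).re := by
    simp [hF, hU.zero]
  rw [hF0, sub_zero] at this
  have hFT : F T = _ := rfl
  linarith

end IsPropagator
end Transport

/-! ### Particle transport in a sector -/

theorem ofNum_one (ψ : Fock Λ) : ofNum (fun _ => 1) ψ = ENNReal.ofReal (‖ψ‖ ^ 2) := by
  have h1 : ∀ m : Config Λ, |(fun _ => 1 : Config Λ → ℝ) m| ≤ 1 := fun _ => abs_one.le
  rw [ofNum_eq_ofReal_inner h1 fun _ => zero_le_one]
  have e : diagOp (fun _ => 1) ψ = ψ := by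
    ext m
    rw [diagOp_apply h1]
    simp
  rw [e]
  exact congrArg ENNReal.ofReal (inner_self_eq_norm_sq (𝕜 := ℂ) ψ)

theorem ofNum_add {a b : Config Λ → ℝ} (ha : ∀ m, 0 ≤ a m) (hb : ∀ m, 0 ≤ b m) (ψ : Fock Λ) :
    ofNum (fun m => a m + b m) ψ = ofNum a ψ + ofNum b ψ := by
  simp only [ofNum, ENNReal.ofReal_add (ha _) (hb _), add_mul, ENNReal.tsum_add]

theorem num_nonneg (Y : Set Λ) (m : Config Λ) : 0 ≤ num Y m := by
  rw [num_eq_occ]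
  exact occ_nonneg (fun x => by split_ifs <;> simp) m

theorem num_mono {Y Z : Set Λ} (h : Y ⊆ Z) (m : Config Λ) : num Y m ≤ num Z m := by
  rw [num_eq_occ, num_eq_occ]
  refine occ_mono (fun x => ?_) m
  by_cases hx : x ∈ Y
  · simp [hx, h hx]
  · simp only [hx, if_false]; split_ifs <;> simp

/-- Bounding `q` of the powers of `N_Y` by powers of the conserved `N` leaves only the first moment
to propagate. -/
theorem num_rpow_mul_le (Y : Set Λ) {q ν : ℝ} (hq : 0 ≤ q) (hν : 0 ≤ ν) (m : Config Λ) :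
    num Y m ^ (q + 1) * num Set.univ m ^ ν ≤ num Set.univ m ^ (ν + q) * num Y m := by
  have h0 := num_nonneg Y m
  have h1 := num_mono (Set.subset_univ Y) m
  have h2 := num_nonneg Set.univ m
  rw [Real.rpow_add_one' h0 (by positivity), Real.rpow_add_of_nonneg h2 hν hq]
  calc num Y m ^ q * num Y m * num Set.univ m ^ ν
      ≤ num Set.univ m ^ q * num Y m * num Set.univ m ^ ν := by gcongr
    _ = _ := by ring

section Transport

variable {h : Λ → Λ → ℂ} {v : Λ → Λ → ℝ} {S : Set Λ} {U : ℝ → (Fock Λ ≃ₗᵢ[ℂ] Fock Λ)}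

namespace IsPropagator

/-- Both sides are continuous in `ψ`, and projecting domain vectors near `ψ` to the sector keeps
them in the domain. -/
theorem inner_front_le [PseudoMetricSpace Λ] (hU : IsPropagator h v S U)
    (hh : ∀ x y, h x y = conj (h y x)) {n : ℕ} (hn : 1 ≤ n) {d : Λ → ℝ}
    (hd : ∀ x y, |d x - d y| ≤ dist x y) {κ κn ε C w s : ℝ} (hκ0 : 0 ≤ κ)
    (hK : ∀ x, ∑' y, ‖hop h S x y‖ₑ ≤ ENNReal.ofReal κ)
    (hκ : ∀ x, ∑' y, ENNReal.ofReal (‖h x y‖ * dist x y) ≤ ENNReal.ofReal κ)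
    (hκn : ∀ x, ∑' y, ENNReal.ofReal (‖h x y‖ * dist x y ^ (n + 1)) ≤ ENNReal.ofReal κn)
    (hε : 0 < ε) (hC : 0 < C) (hκn0 : 0 ≤ κn)
    (hεC : ∀ w r : ℝ, 0 ≤ w → 0 ≤ r → (w + r) ^ n ≤ (1 + ε) * w ^ n + C * r ^ n)
    (hw : (1 + ε) * κ ≤ w) (hs : 0 < s) {σ : ℝ} (hσ : |σ| = 1) {k : ℕ} {ψ : Fock Λ}
    (hψ : ∀ m, m.degree ≠ k → ψ m = 0) {T : ℝ} (hT : 0 ≤ T) :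
    (inner ℂ (U (σ * T) ψ) (secondQuant k (front n S d w s T) (U (σ * T) ψ))).re
      ≤ (inner ℂ ψ (secondQuant k (front n S d w s 0) ψ)).re
        + C * κn / s ^ (n + 1) * (k * ‖ψ‖ ^ 2) * T := by
  obtain ⟨ψ', φ, hlim, hφ⟩ := hU.exists_generator_tendsto ψ
  have hlim' : Filter.Tendsto (fun j => sectorProj k (ψ' j)) Filter.atTop (nhds ψ) := by
    have := ((sectorProj k).continuous.tendsto ψ).comp hlim
    rwa [sectorProj_eq_self hψ] at this
  have hc1 : Continuous fun χ : Fock Λ =>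
      (inner ℂ (U (σ * T) χ) (secondQuant k (front n S d w s T) (U (σ * T) χ))).re :=
    Complex.continuous_re.comp ((U (σ * T)).continuous.inner
      ((secondQuant k _).continuous.comp (U (σ * T)).continuous))
  have hc2 : Continuous fun χ : Fock Λ => (inner ℂ χ (secondQuant k (front n S d w s 0) χ)).re
        + C * κn / s ^ (n + 1) * (k * ‖χ‖ ^ 2) * T :=
    (Complex.continuous_re.comp (continuous_id.inner (secondQuant k _).continuous)).add
      (by fun_prop)
  exact le_of_tendsto_of_tendsto' ((hc1.tendsto ψ).comp hlim') ((hc2.tendsto ψ).comp hlim')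
    fun j => hU.inner_front_le_of_generator hh hn hd hκ0 hK hκ hκn hε hC hκn0 hεC hw hs hσ
      (sectorProj_eq_zero k (ψ' j)) (generator_sectorProj (hφ j) k) hT

theorem ofNum_num_le [PseudoMetricSpace Λ] (hU : IsPropagator h v S U)
    (hh : ∀ x y, h x y = conj (h y x)) {n : ℕ} (hn : 1 ≤ n) {d : Λ → ℝ}
    (hd : ∀ x y, |d x - d y| ≤ dist x y) {κ κn ε C w c : ℝ} (hκ0 : 0 ≤ κ)
    (hK : ∀ x, ∑' y, ‖hop h S x y‖ₑ ≤ ENNReal.ofReal κ)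
    (hκ : ∀ x, ∑' y, ENNReal.ofReal (‖h x y‖ * dist x y) ≤ ENNReal.ofReal κ)
    (hκn : ∀ x, ∑' y, ENNReal.ofReal (‖h x y‖ * dist x y ^ (n + 1)) ≤ ENNReal.ofReal κn)
    (hε : 0 < ε) (hC : 0 < C) (hκn0 : 0 ≤ κn)
    (hεC : ∀ w r : ℝ, 0 ≤ w → 0 ≤ r → (w + r) ^ n ≤ (1 + ε) * w ^ n + C * r ^ n)
    (hw : (1 + ε) * κ ≤ w) (hwc : w < c) {η t : ℝ} (hη : 0 < η) (ht : |t| ≤ η / c)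
    {A B : Set Λ} (hA : ∀ x ∈ A, x ∈ S ∧ η ≤ d x) (hB : ∀ x ∈ S, 0 < d x → x ∈ B)
    {k : ℕ} {ψ : Fock Λ} (hψ : ∀ m, m.degree ≠ k → ψ m = 0) :
    ofNum (num A) (U t ψ) ≤ ofNum (num B) ψ
      + ENNReal.ofReal (C * κn / ((1 - w / c) ^ (n + 1) * c * cut n 1) * (η ^ n)⁻¹
        * (k * ‖ψ‖ ^ 2)) := by
  have hw0 : 0 ≤ w := le_trans (by positivity) hw
  have hc : 0 < c := hw0.trans_lt hwc
  -- The front travels at most `w η / c` up to time `|t|`; the remaining part `r η` of the distance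
  -- `η` is available for its width.
  set r := 1 - w / c with hr
  have hr0 : 0 < r := by rw [hr, sub_pos, div_lt_one hc]; exact hwc
  have hs : 0 < r * η := by positivity
  -- For negative `t` the evolution runs backwards, while the front still moves outwards.
  obtain ⟨σ, hσ, hσt⟩ : ∃ σ : ℝ, |σ| = 1 ∧ σ * |t| = t := by
    rcases le_total 0 t with h | h
    · exact ⟨1, abs_one, by rw [abs_of_nonneg h, one_mul]⟩
    · exact ⟨-1, by simp, by rw [abs_of_nonpos h]; ring⟩
  have hcut := cut_one_pos n
  have h1 := hU.inner_front_le hh hn hd hκ0 hK hκ hκn hε hC hκn0 hεC hw hs hσ hψ (abs_nonneg t)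
  rw [hσt] at h1
  have hsec := hU.apply_eq_zero_of_degree_ne hψ t
  have hlow : ENNReal.ofReal (cut n 1) * ofNum (num A) (U t ψ)
      ≤ ofNum (occ (front n S d w (r * η) |t|)) (U t ψ) := by
    rw [← ofNum_const_mul hcut.le]
    refine ofNum_mono fun m _ => ?_
    classical
    rw [num_eq_occ, ← occ_const_mul]
    refine occ_mono (fun x => ?_) m
    split_ifs with hx
    · obtain ⟨hxS, hxd⟩ := hA x hx
      have h2 : w * |t| ≤ w * (η / c) := by gcongr
      have h3 : 1 ≤ (d x - w * |t|) / (r * η) := by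
        rw [le_div_iff₀ hs, hr]
        have e2 : w * (η / c) = w / c * η := by ring
        linarith
      rw [front, onRegion, if_pos hxS, mul_one, cut_of_one_le hn h3]
    · rw [mul_zero]
      exact front_nonneg hn _ x
  have hup : ofNum (occ (front n S d w (r * η) 0)) ψ
      ≤ ENNReal.ofReal (cut n 1) * ofNum (num B) ψ := by
    rw [← ofNum_const_mul hcut.le]
    refine ofNum_mono fun m _ => ?_
    classical
    rw [num_eq_occ, ← occ_const_mul]
    refine occ_mono (fun x => ?_) m
    have hnn : (0 : ℝ) ≤ cut n 1 * if x ∈ B then 1 else 0 := by split_ifs <;> simp [hcut.le]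
    rw [front, onRegion]
    by_cases hxS : x ∈ S
    · rw [if_pos hxS, mul_zero, sub_zero]
      rcases le_or_gt (d x) 0 with hx | hx
      · rwa [cut_of_nonpos hn (div_nonpos_of_nonpos_of_nonneg hx hs.le)]
      · rw [if_pos (hB x hxS hx), mul_one]
        exact cut_le hn _
    · rwa [if_neg hxS]
  rw [ofNum_occ_eq (front_nonneg hn _) hcut.le (abs_front_le hn _) hsec] at hlow
  rw [ofNum_occ_eq (front_nonneg hn _) hcut.le (abs_front_le hn _) hψ] at hup
  -- The rate is of order `η ^ (-(n + 1))`; the time `|t| ≤ η / c` gives back one power of `η`.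
  have hrate : C * κn / (r * η) ^ (n + 1) * (k * ‖ψ‖ ^ 2) * |t|
      ≤ cut n 1 * (C * κn / (r ^ (n + 1) * c * cut n 1) * (η ^ n)⁻¹ * (k * ‖ψ‖ ^ 2)) := by
    calc _ ≤ C * κn / (r * η) ^ (n + 1) * (k * ‖ψ‖ ^ 2) * (η / c) := by gcongr
      _ = _ := by
        rw [mul_pow, pow_succ η]
        field_simp
  have hfin : ENNReal.ofReal (cut n 1) * ofNum (num A) (U t ψ)
      ≤ ENNReal.ofReal (cut n 1) * (ofNum (num B) ψ
        + ENNReal.ofReal (C * κn / (r ^ (n + 1) * c * cut n 1) * (η ^ n)⁻¹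
          * (k * ‖ψ‖ ^ 2))) := by
    rw [mul_add, ← ENNReal.ofReal_mul hcut.le]
    refine hlow.trans ((ENNReal.ofReal_le_ofReal h1).trans (ENNReal.ofReal_add_le.trans ?_))
    exact add_le_add hup (ENNReal.ofReal_le_ofReal hrate)
  exact (ENNReal.mul_le_mul_iff_right (by simpa using hcut) ENNReal.ofReal_ne_top).1 hfin

/-- Decomposition of a transport estimate for `num A` into sectors. -/
theorem ofNum_rpow_le (hU : IsPropagator h v S U) {A B : Set Λ} {C b t : ℝ} (hC : 0 ≤ C)
    (hb : 0 ≤ b) (hAB : ∀ (k : ℕ) (ψ : Fock Λ), (∀ m, m.degree ≠ k → ψ m = 0) →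
      ofNum (num A) (U t ψ) ≤ ofNum (num B) ψ + ENNReal.ofReal (C * b * (k * ‖ψ‖ ^ 2)))
    {q ν : ℝ} (hq : 0 ≤ q) (hν : 0 ≤ ν) (ψ : Fock Λ) :
    ofNum (fun m => num A m ^ (q + 1) * num Set.univ m ^ ν) (U t ψ)
      ≤ ofNum (fun m => (1 + C) * (num B m * num Set.univ m ^ (ν + q)
        + b * num Set.univ m ^ (ν + q + 1))) ψ := by
  rw [ofNum_eq_tsum_sectorProj, ofNum_eq_tsum_sectorProj _ ψ]
  refine ENNReal.tsum_le_tsum fun k => ?_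
  rw [hU.sectorProj_comm]
  set χ := sectorProj k ψ with hχ
  have hsec : ∀ m, m.degree ≠ k → χ m = 0 := sectorProj_eq_zero k ψ
  have hdeg : ∀ (χ : Fock Λ), (∀ m, m.degree ≠ k → χ m = 0) → ∀ m, χ m ≠ 0 →
      num Set.univ m = k := fun χ hχ m hm => by
    rw [num_univ]
    by_contra h0
    exact hm (hχ m fun h1 => h0 (by rw [h1]))
  have hk : (0 : ℝ) ≤ (k : ℝ) ^ (ν + q) := by positivity
  calc ofNum (fun m => num A m ^ (q + 1) * num Set.univ m ^ ν) (U t χ)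
      ≤ ofNum (fun m => (k : ℝ) ^ (ν + q) * num A m) (U t χ) := ofNum_mono fun m hm => by
        have := num_rpow_mul_le A hq hν m
        rwa [hdeg _ (hU.apply_eq_zero_of_degree_ne hsec t) m hm] at this ⊢
    _ = ENNReal.ofReal ((k : ℝ) ^ (ν + q)) * ofNum (num A) (U t χ) := ofNum_const_mul hk _ _
    _ ≤ ENNReal.ofReal ((k : ℝ) ^ (ν + q))
        * (ofNum (num B) χ + ENNReal.ofReal (C * b * (k * ‖χ‖ ^ 2))) := by
        gcongr
        exact hAB k χ hsec
    _ = ofNum (fun m => (k : ℝ) ^ (ν + q) * (num B m + C * b * k * 1)) χ := by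
        rw [ofNum_const_mul hk, ofNum_add (num_nonneg B) (fun _ => by positivity),
          ofNum_const_mul (by positivity), ofNum_one, ← ENNReal.ofReal_mul (by positivity),
          ← mul_assoc]
    _ ≤ _ := ofNum_mono fun m hm => by
        rw [hdeg χ hsec m hm, Real.rpow_add_one' (Nat.cast_nonneg k) (by positivity)]
        have h1 := mul_nonneg hk (num_nonneg B m)
        have h2 : 0 ≤ (k : ℝ) ^ (ν + q) * (b * k) := by positivity
        nlinarith [mul_nonneg hC h1]

end IsPropagator

/-- Here the grid size enters: off the diagonal `|h x y| ≤ |h x y| |x - y|`. The diagonal of `h`,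
which `κ` does not control, is absent from `hop`. -/
theorem tsum_hop_le [PseudoMetricSpace Λ] (hsep : ∀ x y : Λ, x ≠ y → 1 ≤ dist x y) {κ : ℝ}
    (hκ : ∀ x, ∑' y, ENNReal.ofReal (‖h x y‖ * dist x y) ≤ ENNReal.ofReal κ) (x : Λ) :
    ∑' y, ‖hop h S x y‖ₑ ≤ ENNReal.ofReal κ := by
  refine (ENNReal.tsum_le_tsum fun y => ?_).trans (hκ x)
  unfold hop
  split_ifs with hxy
  · rw [← ofReal_norm]
    exact ENNReal.ofReal_le_ofReal (le_mul_of_one_le_right (norm_nonneg _) (hsep x y hxy.2.2))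
  · simp

theorem tsum_le_of_hopMoment_eq [PseudoMetricSpace Λ] {p : ℕ} {κ : ℝ≥0} (hκ : hopMoment h p = κ)
    (x : Λ) : ∑' y, ENNReal.ofReal (‖h x y‖ * dist x y ^ (p + 1)) ≤ ENNReal.ofReal (κ : ℝ) := by
  rw [ENNReal.ofReal_coe_nnreal, ← hκ, hopMoment]
  exact le_iSup (fun x => ∑' y, ENNReal.ofReal (‖h x y‖ * dist x y ^ (p + 1))) x

/-- A Lipschitz function that separates `X` from the complement of its `η`-neighbourhood. -/
theorem exists_lipschitz_separating [PseudoMetricSpace Λ] (X : Set Λ) (η : ℝ) :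
    ∃ d : Λ → ℝ, (∀ x y, |d x - d y| ≤ dist x y) ∧
      (∀ x ∉ Metric.cthickening η X, η ≤ d x) ∧ ∀ x ∈ X, d x ≤ 0 := by
  rcases X.eq_empty_or_nonempty with rfl | hX
  -- `Metric.infDist` to the empty set is `0`, so this case needs its own function.
  · exact ⟨fun _ => η, fun x y => by simp, fun _ _ => le_rfl, fun x hx => hx.elim⟩
  · refine ⟨fun x => Metric.infDist x X, fun x y => ?_, fun x hx => ?_, fun x hx =>
      (Metric.infDist_zero_of_mem hx).le⟩
    · have := (Metric.lipschitz_infDist_pt X).dist_le_mul x y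
      rwa [NNReal.coe_one, one_mul, Real.dist_eq] at this
    · rw [Metric.mem_cthickening_iff, not_le] at hx
      have h1 := Metric.infEDist_ne_top hX (x := x)
      exact (ENNReal.ofReal_le_iff_le_toReal h1).1 hx.le

end Transport

end LatticeBose

end

/-! ### The theorem: choice of the constants and assembly -/

open LatticeBose in
theorem corollary2p10 (n : ℕ) (hn : 1 ≤ n) (κ κn : ℝ≥0) (c : ℝ) (hc : (κ : ℝ) < c) :
    ∃ C : ℝ, 0 < C ∧
      ∀ (d : ℕ), 1 ≤ d → ∀ (Λ : Set (EuclideanSpace ℝ (Fin d))),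
        (∀ x ∈ Λ, ∀ y ∈ Λ, x ≠ y → 1 ≤ dist x y) →
      ∀ (h : Λ → Λ → ℂ) (v : Λ → Λ → ℝ),
        (∀ x y, h x y = conj (h y x)) → (∀ x y, v x y = v y x) →
        hopMoment h 0 = κ → hopMoment h n = κn →
      ∀ (ν q : ℝ), 0 ≤ ν → 0 ≤ q →
      ∀ (η : ℝ), 1 ≤ η → ∀ (X S : Set Λ), X ⊆ S →
      ∀ (t : ℝ), |t| < η / c →
        OpLE
          (evol h v S t
            (ofNum fun m => num (S \ Metric.cthickening η X) m ^ (q + 1) * num Set.univ m ^ ν))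
          (ofNum fun m =>
            C * (num (S \ X) m * num Set.univ m ^ (ν + q)
              + (η ^ n)⁻¹ * num Set.univ m ^ (ν + q + 1))) := by
  have hκ0 : (0 : ℝ) ≤ κ := κ.coe_nonneg
  have hκn0 : (0 : ℝ) ≤ κn := κn.coe_nonneg
  set w : ℝ := (κ + c) / 2 with hw
  have hwc : w < c := by rw [hw]; linarith
  have hκw : κ < w := by rw [hw]; linarith
  -- Chosen to give `(1 + ε) * κ ≤ w`; the denominator is `κ + 1` because `κ` may vanish.
  set ε : ℝ := (w - κ) / (κ + 1) with hε
  have hε0 : 0 < ε := div_pos (by linarith) (by linarith)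
  have hεw : (1 + ε) * κ ≤ w := by
    have h1 : ε * (κ + 1) = w - κ := by rw [hε]; field_simp
    linarith
  have hc0 : 0 < c := hκ0.trans_lt hc
  have hr0 : 0 < 1 - w / c := by rw [sub_pos, div_lt_one hc0]; exact hwc
  obtain ⟨C₀, hC₀, hεC⟩ := exists_add_pow_le n hε0
  have hcut := cut_one_pos n
  set C₁ : ℝ := C₀ * κn / ((1 - w / c) ^ (n + 1) * c * cut n 1) with hC₁
  have hC₁0 : 0 ≤ C₁ := by positivity
  refine ⟨1 + C₁, by positivity, ?_⟩
  intro d _ Λ hsep h v hh _ hκ hκn ν q hν hq η hη X S _ t ht ρ _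
  have hη0 : 0 < η := by linarith
  -- Both expectations are sums over the same vectors `ρ^{1/2} e_m`, so it suffices to compare the
  -- quadratic forms on each vector.
  refine ENNReal.tsum_le_tsum fun m₀ => ?_
  set ψ := sqrtOp ρ (basisVec m₀)
  unfold evol propagator
  split_ifs with H
  · obtain ⟨δ, hδ, hδη, hδX⟩ := exists_lipschitz_separating X η
    have hκ' : ∀ x, ∑' y, ENNReal.ofReal (‖h x y‖ * dist x y) ≤ ENNReal.ofReal (κ : ℝ) := by
      simpa using fun x => tsum_le_of_hopMoment_eq hκ x
    have hsep' : ∀ x y : Λ, x ≠ y → 1 ≤ dist x y := fun x y hxy =>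
      hsep x x.2 y y.2 (Subtype.coe_injective.ne hxy)
    have hK : ∀ x, ∑' y, ‖hop h S x y‖ₑ ≤ ENNReal.ofReal (κ : ℝ) := tsum_hop_le hsep' hκ'
    have hA : ∀ x ∈ S \ Metric.cthickening η X, x ∈ S ∧ η ≤ δ x :=
      fun x hx => ⟨hx.1, hδη x hx.2⟩
    have hB : ∀ x ∈ S, 0 < δ x → x ∈ S \ X :=
      fun x hxS hx => ⟨hxS, fun hxX => (hδX x hxX).not_gt hx⟩
    exact H.choose_spec.ofNum_rpow_le hC₁0 (by positivity) (fun k χ hχ =>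
      H.choose_spec.ofNum_num_le hh hn hδ hκ0 hK hκ' (tsum_le_of_hopMoment_eq hκn) hε0 hC₀ hκn0
        hεC hεw hwc hη0 ht.le hA hB hχ) hq hν ψ
  -- In the fallback branch the propagator is the identity, and the inequality holds pointwise in
  -- the occupation numbers because `X` lies in its neighbourhood.
  · refine ofNum_mono fun m _ => (num_rpow_mul_le _ hq hν m).trans ?_
    have h1 : num (S \ Metric.cthickening η X) m ≤ num (S \ X) m :=
      num_mono (Set.sdiff_subset_sdiff_right (Metric.self_subset_cthickening X)) m
    have h2 := num_nonneg (Set.univ : Set Λ) m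
    have h3 := num_nonneg (S \ X) m
    have h4 : 0 ≤ num (Set.univ : Set Λ) m ^ (ν + q) := by positivity
    have h5 : 0 ≤ (η ^ n)⁻¹ * num (Set.univ : Set Λ) m ^ (ν + q + 1) := by positivity
    nlinarith [mul_le_mul_of_nonneg_left h1 h4, mul_nonneg hC₁0 (mul_nonneg h3 h4),
      mul_nonneg hC₁0 h5]
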